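/- Scalars are real or complex. Let $2<p<\infty$, let $q$ be the conjugate exponent, $\frac1p+\frac1q=1$, and let $w=(w_n)_{n\ge 0}$ be a sequence of positive real numbers such that $$\sum_{n:\,w_n<\varepsilon} w_n^{\frac{2p}{p-2}}=\infty\qquad\text{for every }\varepsilon>0 .$$ Let $X_{p,w}$ be the Banach space of all scalar sequences $x=(x_n)$ for which $$\|x\|=\max\Bigl\{\bigl(\sum_n|x_n|^p\bigr)^{1/p},\ \bigl(\sum_n|w_nx_n|^2\bigr)^{1/2}\Bigr\}$$ is finite. For $1\le s<\infty$ let $(\ell_2\oplus\ell_2\oplus\cdots)_{\ell_s}$ be the space of sequences $(x^{(j)})$ in $\ell_2$ with norm $\bigl(\sum_j\|x^{(j)}\|_{\ell_2}^s\bigr)^{1/s}<\infty$. A sequence $(f_n)$ in a Banach space is *basic* if every element of its closed linear span has a unique expansion $\sum a_nf_n$, convergent in norm. Two basic sequences $(f_n)$, $(g_n)$ are *equivalent* if for every scalar sequence $(a_n)$ the series $\sum a_nf_n$ converges if and only if $\sum a_ng_n$ does; they are *$K$-equivalent* if, moreover, there is a constant $L>0$ such that $\|\sum a_nf_n\|\le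 K\,L\|\sum a_ng_n\|$ and $L\|\sum a_ng_n\|\le K\|\sum a_nf_n\|$ for all $(a_n)$ for which the series converge. A Banach space $X$ satisfies $\mathcal P_2$ if for every $\varepsilon>0$, every basic sequence in $X$ equivalent to the standard basis of $\ell_2$ has a subsequence that is $(1+\varepsilon)$-equivalent to the standard basis of $\ell_2$. Then: 1. For every closed subspace $V$ of $\ell_p$, there is no continuous linear map of $(\ell_2\oplus\ell_2\oplus\cdots)_{\ell_p}\oplus V$ onto $X_{p,w}$. 2. The dual $X_{p,w}^*$ fails $\mathcal P_2$; moreover, no Banach space isomorphic to $X_{p,w}^*$ satisfies $\mathcal P_2$. 3. If $Y$ is a Banach space isomorphic to a quotient of $\ell_q$ by a closed subspace, then $(\ell_2\oplus\ell_2\oplus\cdots)_{\ell_q}\oplus Y$ satisfies $\mathcal P_2$, where the direct sum carries the $\ell_r$-sum norm for any $r\in[1,\infty]$. 4. $X_{p,w}$ is isomorphic to none of $\ell_2$, $\ell_p$, $\ell_2\oplus\ell_p$, $(\ell_2\oplus\ell_2\oplus\cdots)_{\ell_p}$. -/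

import Mathlib

open Filter Topology
open scoped ENNReal

noncomputable section

/-- The scalar sequence space `ℓ_p` over `𝕜`, indexed by `ℕ`. -/
abbrev SeqLp (𝕜 : Type) [RCLike 𝕜] (p : ℝ≥0∞) : Type :=
  lp (fun _ : ℕ => 𝕜) p

/-- The space `(ℓ_2 ⊕ ℓ_2 ⊕ ⋯)_{ℓ_p}` of sequences `x` in `ℓ_2` with `(‖x_i‖) ∈ ℓ_p`. -/
abbrev SumSeqL2 (𝕜 : Type) [RCLike 𝕜] (p : ℝ≥0∞) : Type :=
  lp (fun _ : ℕ => SeqLp 𝕜 2) p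

/-- The scalar sequences `x` such that `x ∈ ℓ_p` and `(w_n x_n) ∈ ℓ_2`. -/
def weightedSubmodule (𝕜 : Type) [RCLike 𝕜] (p : ℝ≥0∞) (w : ℕ → ℝ) : Submodule 𝕜 (ℕ → 𝕜) where
  carrier := {x | Memℓp x p ∧ Memℓp (fun n => (w n : 𝕜) * x n) 2}
  zero_mem' := by
    refine ⟨zero_memℓp, ?_⟩
    have h : (fun n => (w n : 𝕜) * (0 : ℕ → 𝕜) n) = 0 := by ext n; simp
    rw [h]
    exact zero_memℓp
  add_mem' := by
    rintro x y ⟨hx, hx'⟩ ⟨hy, hy'⟩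
    refine ⟨hx.add hy, ?_⟩
    have h : (fun n => (w n : 𝕜) * (x + y) n)
        = (fun n => (w n : 𝕜) * x n) + fun n => (w n : 𝕜) * y n := by
      ext n; simp [mul_add]
    rw [h]
    exact hx'.add hy'
  smul_mem' := by
    rintro c x ⟨hx, hx'⟩
    refine ⟨hx.const_smul c, ?_⟩
    have h : (fun n => (w n : 𝕜) * (c • x) n) = c • fun n => (w n : 𝕜) * x n := by
      ext n; simp [mul_left_comm]
    rw [h]
    exact hx'.const_smul c

/-- The weighted sequence space `X_{p,w}`; its norm is introduced below. -/
def XSpace (𝕜 : Type) [RCLike 𝕜] (p : ℝ≥0∞) (w : ℕ → ℝ) : Type :=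
  weightedSubmodule 𝕜 p w

namespace XSpace

variable {𝕜 : Type} [RCLike 𝕜] {p : ℝ≥0∞} {w : ℕ → ℝ}

instance : AddCommGroup (XSpace 𝕜 p w) :=
  inferInstanceAs (AddCommGroup (weightedSubmodule 𝕜 p w))

instance : Module 𝕜 (XSpace 𝕜 p w) :=
  inferInstanceAs (Module 𝕜 (weightedSubmodule 𝕜 p w))

/-- The terms of an element of `X_{p,w}`. -/
def coord (x : XSpace 𝕜 p w) : ℕ → 𝕜 :=
  Subtype.val (p := fun y => y ∈ weightedSubmodule 𝕜 p w) x

variable (𝕜 p w) in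
/-- The injection `x ↦ (x, (w_n x_n))` of `X_{p,w}` into `ℓ_p × ℓ_2` with the maximum norm. -/
def toProd : XSpace 𝕜 p w →ₗ[𝕜] SeqLp 𝕜 p × SeqLp 𝕜 2 where
  toFun x := (⟨x.1, x.2.1⟩, ⟨fun n => (w n : 𝕜) * x.1 n, x.2.2⟩)
  map_add' x y := by
    refine Prod.ext (lp.ext rfl) (lp.ext ?_)
    funext n
    exact mul_add (w n : 𝕜) (x.1 n) (y.1 n)
  map_smul' c x := by
    refine Prod.ext (lp.ext rfl) (lp.ext ?_)
    funext n
    exact mul_left_comm (w n : 𝕜) c (x.1 n)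

theorem toProd_injective : Function.Injective (toProd 𝕜 p w) := by
  intro x y h
  have h1 := congrArg (fun z => (z.1 : ℕ → 𝕜)) h
  exact Subtype.ext h1

/-- The norm of `X_{p,w}`: the maximum of the `ℓ_p` norm and the weighted `ℓ_2` norm. -/
instance [Fact (1 ≤ p)] : NormedAddCommGroup (XSpace 𝕜 p w) :=
  NormedAddCommGroup.induced _ _ (toProd 𝕜 p w) toProd_injective

instance [Fact (1 ≤ p)] : NormedSpace 𝕜 (XSpace 𝕜 p w) :=
  NormedSpace.induced 𝕜 (XSpace 𝕜 p w) (SeqLp 𝕜 p × SeqLp 𝕜 2) (toProd 𝕜 p w)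

theorem norm_eq [Fact (1 ≤ p)] (hp : p ≠ ∞) (x : XSpace 𝕜 p w) :
    ‖x‖ = max ((∑' n, ‖x.coord n‖ ^ p.toReal) ^ (1 / p.toReal))
      ((∑' n, ‖(w n : 𝕜) * x.coord n‖ ^ (2 : ℝ)) ^ (1 / 2 : ℝ)) := by
  have h1 : ‖x‖ = max ‖(toProd 𝕜 p w x).1‖ ‖(toProd 𝕜 p w x).2‖ := rfl
  have hp0 : 0 < p.toReal :=
    ENNReal.toReal_pos (zero_lt_one.trans_le (Fact.out : 1 ≤ p)).ne' hp
  rw [h1, lp.norm_eq_tsum_rpow hp0, lp.norm_eq_tsum_rpow (by norm_num)]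
  simp only [ENNReal.toReal_ofNat]
  rfl

end XSpace

/-- The slow decay condition on the weights: for each `ε > 0`, the sum of `w_n ^ (2p / (p - 2))` over those `n` with
`w_n < ε` diverges. It is used for positive `w` only. -/
def ConditionStar (p : ℝ≥0∞) (w : ℕ → ℝ) : Prop :=
  ∀ ε : ℝ, 0 < ε →
    ¬ Summable (fun n : {n : ℕ // w n < ε} => w n ^ (2 * p.toReal / (p.toReal - 2)))

section Sequences

variable (𝕜 : Type*) [RCLike 𝕜]
variable {X : Type*} [NormedAddCommGroup X] [NormedSpace 𝕜 X]
variable {Y : Type*} [NormedAddCommGroup Y] [NormedSpace 𝕜 Y]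

/-- The series `∑ a_n x_n` converges in norm to `s`. -/
def SeriesTendsto (x : ℕ → X) (a : ℕ → 𝕜) (s : X) : Prop :=
  Tendsto (fun N => ∑ n ∈ Finset.range N, a n • x n) atTop (𝓝 s)

/-- `x` is a Schauder basis of its closed linear span. -/
def IsBasicSeq (x : ℕ → X) : Prop :=
  ∀ s ∈ (Submodule.span 𝕜 (Set.range x)).topologicalClosure, ∃! a : ℕ → 𝕜, SeriesTendsto 𝕜 x a s

/-- Equivalence of basic sequences: the series `∑ a_n x_n` and `∑ a_n y_n` converge for the same
scalar sequences `a`. -/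
def EquivalentSeq (x : ℕ → X) (y : ℕ → Y) : Prop :=
  IsBasicSeq 𝕜 x ∧ IsBasicSeq 𝕜 y ∧
    ∀ a : ℕ → 𝕜, (∃ s, SeriesTendsto 𝕜 x a s) ↔ ∃ t, SeriesTendsto 𝕜 y a t

/-- `K`-equivalence of basic sequences that need not be normalized: after a rescaling of `y` by
one positive constant `L`, the norms of corresponding sums agree up to the factor `K`. -/
def KEquivalentSeq (K : ℝ) (x : ℕ → X) (y : ℕ → Y) : Prop :=
  EquivalentSeq 𝕜 x y ∧
    ∃ L : ℝ, 0 < L ∧ ∀ (a : ℕ → 𝕜) (s : X) (t : Y),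
      SeriesTendsto 𝕜 x a s → SeriesTendsto 𝕜 y a t →
        ‖s‖ ≤ K * (L * ‖t‖) ∧ L * ‖t‖ ≤ K * ‖s‖

end Sequences

/-- The standard basis of `ℓ_2`. -/
def stdBasisL2 (𝕜 : Type) [RCLike 𝕜] (n : ℕ) : SeqLp 𝕜 2 :=
  lp.single 2 n (1 : 𝕜)

/-- Property `P₂`: for each `ε > 0`, every sequence in `X` equivalent to the standard basis of
`ℓ_2` has a subsequence that is `(1 + ε)`-equivalent to the standard basis of `ℓ_2`. -/
def PropertyP2 (𝕜 : Type) [RCLike 𝕜] (X : Type*) [NormedAddCommGroup X] [NormedSpace 𝕜 X] : Prop :=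
  ∀ ε : ℝ, 0 < ε → ∀ f : ℕ → X, EquivalentSeq 𝕜 f (stdBasisL2 𝕜) →
    ∃ φ : ℕ → ℕ, StrictMono φ ∧ KEquivalentSeq 𝕜 (1 + ε) (f ∘ φ) (stdBasisL2 𝕜)

end

/-! Property `P₂` separates the dual of `X_{p,w}` from every space that the dual of the proposed
domain embeds into.

Failure. For a finite set `E` put `σ(E) = ∑_{n ∈ E} w_n^{2p/(p-2)}`. The vector on `E` with entries
proportional to `w_n^{2/(p-2)}` can be normalized to have `ℓ_p` norm `1` and weighted `ℓ_2` norm `v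
= σ(E)^{1/2-1/p}`. Divergence of the sums over small weights yields infinitely many disjoint sets
with `σ(E)` within a factor `2` of any prescribed value. With `v ≤ V ≤ 1`, the biorthogonal
functionals have norm at most `1` and are equivalent to the `ℓ_2` basis. Yet sums of `N` block
vectors have norm at most `V√N` for large `N`, so by pairing, sums of `N` functionals have norm at
least `√N / V`. As `V` is arbitrary, no fixed equivalence constant survives passage to subsequences,
even in a space merely containing a copy of the dual (`not_propertyP2_of_embedding`).

Success. Since `q < 2`, a Pitt-type argument (`lp.not_forall_le_norm_of_escaping`) shows that an
operator from `ℓ_2` into the `ℓ_q`-sum of copies of `ℓ_2` is concentrated on finitely many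
coordinates up to a small error, and that an operator from `ℓ_2` into a quotient of `ℓ_q` is small
on tails. What remains is finitely many operators between Hilbert spaces. Along a subsequence of the
basis each is almost a multiple of an isometry, so the original embedding is too
(`propertyP2_withLp`).

Conclusion. A surjection from the `ℓ_p`-sum plus `V` onto `X_{p,w}` would dualize to an embedding of
the dual of `X_{p,w}` into the `ℓ_q`-sum plus `V*`. As `V*` is a quotient of `ℓ_q`, the two facts
above contradict each other. The four classical spaces are all quotients of the `ℓ_p`-sum plus
`ℓ_p`. -/

noncomputable section

/-! ### Sequences with two-sided `ℓ_2` estimates. -/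

section L2Bounds

variable {𝕜 : Type} [RCLike 𝕜]
variable {X : Type*} [NormedAddCommGroup X] [NormedSpace 𝕜 X]
variable {Y : Type*} [NormedAddCommGroup Y] [NormedSpace 𝕜 Y]

/-- The `ℓ_2` norm of the first `N` terms of a scalar sequence. -/
def l2Trunc (a : ℕ → 𝕜) (N : ℕ) : ℝ := √(∑ n ∈ Finset.range N, ‖a n‖ ^ 2)

theorem l2Trunc_nonneg (a : ℕ → 𝕜) (N : ℕ) : 0 ≤ l2Trunc a N := Real.sqrt_nonneg _

theorem l2Trunc_sq (a : ℕ → 𝕜) (N : ℕ) :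
    l2Trunc a N ^ 2 = ∑ n ∈ Finset.range N, ‖a n‖ ^ 2 :=
  Real.sq_sqrt (Finset.sum_nonneg fun _ _ => by positivity)

theorem norm_le_l2Trunc (a : ℕ → 𝕜) {n N : ℕ} (h : n < N) : ‖a n‖ ≤ l2Trunc a N := by
  refine Real.le_sqrt_of_sq_le ?_
  exact Finset.single_le_sum (f := fun n => ‖a n‖ ^ 2) (fun _ _ => by positivity)
    (Finset.mem_range.2 h)

variable (𝕜) in
/-- Finite linear combinations of `f` have norm between `c` and `C` times the `ℓ_2` norm of
the coefficients. -/
def HasL2Bounds (c C : ℝ) (f : ℕ → X) : Prop :=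
  ∀ (a : ℕ → 𝕜) (N : ℕ), c * l2Trunc a N ≤ ‖∑ n ∈ Finset.range N, a n • f n‖ ∧
    ‖∑ n ∈ Finset.range N, a n • f n‖ ≤ C * l2Trunc a N

theorem stdBasisL2_apply (n m : ℕ) : stdBasisL2 𝕜 n m = if m = n then 1 else 0 := by
  rw [stdBasisL2, lp.single_apply]
  simp [Pi.single_apply]

theorem smul_stdBasisL2 (n : ℕ) (c : 𝕜) : c • stdBasisL2 𝕜 n = lp.single 2 n c := by
  rw [stdBasisL2, ← lp.single_smul, smul_eq_mul, mul_one]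

theorem norm_sum_smul_stdBasisL2 (a : ℕ → 𝕜) (N : ℕ) :
    ‖∑ n ∈ Finset.range N, a n • stdBasisL2 𝕜 n‖ = l2Trunc a N := by
  have h := lp.norm_sum_single (p := 2) (E := fun _ : ℕ => 𝕜) (by norm_num) a (Finset.range N)
  simp only [smul_stdBasisL2]
  rw [l2Trunc, ← Real.sqrt_sq (norm_nonneg (∑ n ∈ Finset.range N, lp.single 2 n (a n)))]
  congr 1
  simpa using h

theorem hasL2Bounds_stdBasisL2 : HasL2Bounds 𝕜 1 1 (stdBasisL2 𝕜) := fun a N => by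
  simp [norm_sum_smul_stdBasisL2]

theorem seriesTendsto_stdBasisL2 (x : SeqLp 𝕜 2) : SeriesTendsto 𝕜 (stdBasisL2 𝕜) x x := by
  have h := (lp.hasSum_single (p := 2) (E := fun _ : ℕ => 𝕜) (by norm_num) x).tendsto_sum_nat
  simpa only [SeriesTendsto, smul_stdBasisL2] using h

theorem sum_range_sub_sum_range_eq (f : ℕ → X) (a : ℕ → 𝕜) {M N : ℕ} (h : M ≤ N) :
    ∑ n ∈ Finset.range N, a n • f n - ∑ n ∈ Finset.range M, a n • f n =
      ∑ n ∈ Finset.range N, (if n < M then 0 else a n) • f n := by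
  rw [← Finset.sum_Ico_eq_sub _ h, ← Finset.sum_range_add_sum_Ico
    (fun n => (if n < M then 0 else a n) • f n) h, Finset.sum_eq_zero (s := Finset.range M),
    zero_add]
  · refine Finset.sum_congr rfl fun n hn => ?_
    simp [not_lt.2 (Finset.mem_Ico.1 hn).1]
  · intro n hn
    simp [Finset.mem_range.1 hn]

/-- A difference of partial sums is a partial sum with the early coefficients zeroed, so estimates
on initial sums alone transfer the Cauchy property from one sequence to another. -/
theorem HasL2Bounds.norm_sub_le {c C c' C' : ℝ} {f : ℕ → X} {g : ℕ → Y}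
    (hf : HasL2Bounds 𝕜 c C f) (hg : HasL2Bounds 𝕜 c' C' g) (hC : 0 ≤ C) (hc' : 0 < c')
    (a : ℕ → 𝕜) (M N : ℕ) :
    ‖∑ n ∈ Finset.range N, a n • f n - ∑ n ∈ Finset.range M, a n • f n‖ ≤
      C / c' * ‖∑ n ∈ Finset.range N, a n • g n - ∑ n ∈ Finset.range M, a n • g n‖ := by
  wlog h : M ≤ N generalizing M N
  · have := this N M (by omega)
    rwa [norm_sub_rev, norm_sub_rev (∑ n ∈ Finset.range N, a n • g n)]
  rw [sum_range_sub_sum_range_eq f a h, sum_range_sub_sum_range_eq g a h]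
  refine (hf _ N).2.trans ?_
  rw [div_mul_eq_mul_div, le_div_iff₀ hc', mul_assoc, mul_comm _ c']
  exact mul_le_mul_of_nonneg_left (hg _ N).1 hC

theorem seriesTendsto_of_support {f : ℕ → X} (a : ℕ → 𝕜) (N : ℕ) (ha : ∀ n, N ≤ n → a n = 0) :
    SeriesTendsto 𝕜 f a (∑ n ∈ Finset.range N, a n • f n) := by
  refine tendsto_const_nhds.congr' ?_
  filter_upwards [eventually_ge_atTop N] with M hM
  rw [← Finset.sum_range_add_sum_Ico _ hM, left_eq_add]
  exact Finset.sum_eq_zero fun n hn => by rw [ha n (Finset.mem_Ico.1 hn).1, zero_smul]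

theorem seriesTendsto_stdBasisL2_coeff (f : ℕ → X) (n : ℕ) :
    SeriesTendsto 𝕜 f (stdBasisL2 𝕜 n) (f n) := by
  have h := seriesTendsto_of_support (f := f) (stdBasisL2 𝕜 n) (n + 1) fun m hm => by
    rw [stdBasisL2_apply, if_neg (by omega)]
  rw [Finset.sum_range_succ, Finset.sum_eq_zero, stdBasisL2_apply] at h
  · simpa using h
  · intro m hm
    rw [stdBasisL2_apply, if_neg (Finset.mem_range.1 hm).ne, zero_smul]

theorem HasL2Bounds.exists_seriesTendsto [CompleteSpace X] {c C c' C' : ℝ} {f : ℕ → X} {g : ℕ → Y}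
    (hf : HasL2Bounds 𝕜 c C f) (hg : HasL2Bounds 𝕜 c' C' g) (hC : 0 ≤ C) (hc' : 0 < c')
    {a : ℕ → 𝕜} (h : ∃ t, SeriesTendsto 𝕜 g a t) : ∃ s, SeriesTendsto 𝕜 f a s := by
  obtain ⟨t, ht⟩ := h
  refine cauchySeq_tendsto_of_complete ?_
  have hcg := Filter.Tendsto.cauchySeq ht
  rw [Metric.cauchySeq_iff] at hcg ⊢
  intro ε hε
  obtain ⟨K, hK⟩ := hcg (ε / (C / c' + 1)) (by positivity)
  refine ⟨K, fun m hm n hn => ?_⟩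
  have h1 := hK m hm n hn
  rw [dist_eq_norm] at h1 ⊢
  refine (hf.norm_sub_le hg hC hc' a n m).trans_lt ?_
  have hpos : 0 < C / c' + 1 := by positivity
  rw [lt_div_iff₀ hpos] at h1
  refine lt_of_le_of_lt ?_ h1
  rw [mul_comm]
  exact mul_le_mul_of_nonneg_left (by linarith) (norm_nonneg _)

theorem HasL2Bounds.seriesTendsto_norm {c C : ℝ} {f : ℕ → X} (hf : HasL2Bounds 𝕜 c C f)
    {a : ℕ → 𝕜} {s : X} {t : SeqLp 𝕜 2} (hs : SeriesTendsto 𝕜 f a s)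
    (ht : SeriesTendsto 𝕜 (stdBasisL2 𝕜) a t) : c * ‖t‖ ≤ ‖s‖ ∧ ‖s‖ ≤ C * ‖t‖ := by
  have h1 := hs.norm
  have h2 := ht.norm
  simp only [norm_sum_smul_stdBasisL2] at h2
  exact ⟨le_of_tendsto_of_tendsto' (h2.const_mul c) h1 fun N => (hf a N).1,
    le_of_tendsto_of_tendsto' h1 (h2.const_mul C) fun N => (hf a N).2⟩

theorem HasL2Bounds.coeff_unique {c C : ℝ} {f : ℕ → X} (hf : HasL2Bounds 𝕜 c C f) (hc : 0 < c)
    {a b : ℕ → 𝕜} {s : X} (ha : SeriesTendsto 𝕜 f a s) (hb : SeriesTendsto 𝕜 f b s) : a = b := by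
  have h := ha.sub hb
  simp only [← Finset.sum_sub_distrib, ← sub_smul, sub_self] at h
  have h' := h.norm
  rw [norm_zero] at h'
  funext m
  have : c * ‖a m - b m‖ ≤ 0 := by
    refine ge_of_tendsto h' ?_
    filter_upwards [eventually_gt_atTop m] with N hN
    refine le_trans ?_ (hf (fun n => a n - b n) N).1
    exact mul_le_mul_of_nonneg_left (norm_le_l2Trunc (fun n => a n - b n) hN) hc.le
  have h0 : ‖a m - b m‖ ≤ 0 := by
    by_contra hne
    push Not at hne
    exact absurd this (not_le.2 (mul_pos hc hne))
  exact sub_eq_zero.1 (norm_le_zero_iff.1 h0)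

/-- A sequence with an upper `ℓ_2` estimate is the image of the standard basis under a bounded
operator. -/
theorem HasL2Bounds.exists_clm [CompleteSpace X] {c C : ℝ} {f : ℕ → X}
    (hf : HasL2Bounds 𝕜 c C f) (hC : 0 ≤ C) :
    ∃ S : SeqLp 𝕜 2 →L[𝕜] X, (∀ x : SeqLp 𝕜 2, SeriesTendsto 𝕜 f x (S x)) ∧
      ∀ x, c * ‖x‖ ≤ ‖S x‖ ∧ ‖S x‖ ≤ C * ‖x‖ := by
  have hex : ∀ x : SeqLp 𝕜 2, ∃ s, SeriesTendsto 𝕜 f x s := fun x =>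
    hf.exists_seriesTendsto hasL2Bounds_stdBasisL2 hC one_pos ⟨x, seriesTendsto_stdBasisL2 x⟩
  choose S hS using hex
  have hb : ∀ x, c * ‖x‖ ≤ ‖S x‖ ∧ ‖S x‖ ≤ C * ‖x‖ := fun x =>
    hf.seriesTendsto_norm (hS x) (seriesTendsto_stdBasisL2 x)
  let S' : SeqLp 𝕜 2 →ₗ[𝕜] X :=
    { toFun := S
      map_add' := fun x y => by
        refine tendsto_nhds_unique (hS (x + y)) ?_
        have := (hS x).add (hS y)
        simpa only [← Finset.sum_add_distrib, ← add_smul, SeriesTendsto, lp.coeFn_add,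
          Pi.add_apply] using this
      map_smul' := fun r x => by
        change S (r • x) = r • S x
        refine tendsto_nhds_unique (hS (r • x)) ?_
        have := Filter.Tendsto.const_smul (hS x) r
        simpa only [Finset.smul_sum, smul_smul, SeriesTendsto, lp.coeFn_smul, Pi.smul_apply,
          smul_eq_mul] using this }
  exact ⟨S'.mkContinuous C fun x => (hb x).2, hS, hb⟩

/-- The lower estimate makes the range of the induced operator closed, so it contains the closed
span and every element of that span has an expansion. -/
theorem HasL2Bounds.isBasicSeq [CompleteSpace X] {c C : ℝ} {f : ℕ → X}
    (hf : HasL2Bounds 𝕜 c C f) (hc : 0 < c) (hC : 0 ≤ C) : IsBasicSeq 𝕜 f := by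
  obtain ⟨S, hS, hb⟩ := hf.exists_clm hC
  have hSe : ∀ n, S (stdBasisL2 𝕜 n) = f n := fun n =>
    tendsto_nhds_unique (hS (stdBasisL2 𝕜 n)) (seriesTendsto_stdBasisL2_coeff f n)
  have hcl : IsClosed (S.range : Set X) := by
    have hanti : AntilipschitzWith (Real.toNNReal c⁻¹) S := by
      refine AddMonoidHomClass.antilipschitz_of_bound S fun x => ?_
      rw [Real.coe_toNNReal _ (by positivity), inv_mul_eq_div, le_div_iff₀ hc, mul_comm]
      exact (hb x).1
    have := hanti.isClosed_range S.uniformContinuous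
    rwa [← ContinuousLinearMap.range_toLinearMap, ← LinearMap.coe_range] at this
  intro s hs
  have hle : Submodule.span 𝕜 (Set.range f) ≤ S.range := by
    rw [Submodule.span_le]
    rintro _ ⟨n, rfl⟩
    exact ⟨_, hSe n⟩
  obtain ⟨x, rfl⟩ := Submodule.topologicalClosure_minimal _ hle hcl hs
  exact ⟨x, hS x, fun b hb' => hf.coeff_unique hc hb' (hS x)⟩

theorem HasL2Bounds.equivalentSeq [CompleteSpace X] {c C : ℝ} {f : ℕ → X}
    (hf : HasL2Bounds 𝕜 c C f) (hc : 0 < c) (hC : 0 ≤ C) :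
    EquivalentSeq 𝕜 f (stdBasisL2 𝕜) :=
  ⟨hf.isBasicSeq hc hC, hasL2Bounds_stdBasisL2.isBasicSeq one_pos zero_le_one, fun _ =>
    ⟨hasL2Bounds_stdBasisL2.exists_seriesTendsto hf zero_le_one hc,
      hf.exists_seriesTendsto hasL2Bounds_stdBasisL2 hC one_pos⟩⟩

/-- A sequence equivalent to the standard basis of `ℓ_2` is its image under an isomorphic
embedding. -/
theorem EquivalentSeq.exists_clm [CompleteSpace X] {f : ℕ → X}
    (hf : EquivalentSeq 𝕜 f (stdBasisL2 𝕜)) :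
    ∃ (S : SeqLp 𝕜 2 →L[𝕜] X) (c : ℝ), 0 < c ∧ (∀ n, S (stdBasisL2 𝕜 n) = f n) ∧
      ∀ x, c * ‖x‖ ≤ ‖S x‖ := by
  obtain ⟨hbf, hbe, hiff⟩ := hf
  have hex : ∀ x : SeqLp 𝕜 2, ∃ s, SeriesTendsto 𝕜 f x s := fun x =>
    (hiff x).2 ⟨x, seriesTendsto_stdBasisL2 x⟩
  choose S₀ hS₀ using hex
  -- The partial-sum operators converge pointwise, so by Banach–Steinhaus their limit is continuous.
  let g : ℕ → SeqLp 𝕜 2 →L[𝕜] X := fun N =>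
    ∑ n ∈ Finset.range N, (lp.evalCLM 𝕜 (fun _ : ℕ => 𝕜) 2 n).smulRight (f n)
  have hg : Tendsto (fun N x => g N x) atTop (𝓝 S₀) := by
    rw [tendsto_pi_nhds]
    intro x
    refine (hS₀ x).congr fun N => ?_
    simp only [g, sum_apply, ContinuousLinearMap.smulRight_apply]
    rfl
  let S := continuousLinearMapOfTendsto (σ₁₂ := RingHom.id 𝕜) g hg
  have hS : ∀ x : SeqLp 𝕜 2, SeriesTendsto 𝕜 f x (S x) := hS₀
  have hsp : ∀ s ∈ (Submodule.span 𝕜 (Set.range f)).topologicalClosure, ∃ x, S x = s := by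
    intro s hs
    obtain ⟨a, ha, -⟩ := hbf s hs
    obtain ⟨x, hx⟩ := (hiff a).1 ⟨s, ha⟩
    have hax : a = x := hasL2Bounds_stdBasisL2.coeff_unique one_pos hx (seriesTendsto_stdBasisL2 x)
    refine ⟨x, tendsto_nhds_unique (hS x) ?_⟩
    rw [← hax]; exact ha
  have hmem : ∀ x, S x ∈ (Submodule.span 𝕜 (Set.range f)).topologicalClosure := by
    intro x
    refine mem_closure_of_tendsto (hS x) (Eventually.of_forall fun N => ?_)
    exact Submodule.sum_mem _ fun n _ =>
      Submodule.smul_mem _ _ (Submodule.subset_span ⟨n, rfl⟩)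
  have hinj : Function.Injective S := by
    intro x y hxy
    obtain ⟨a, -, hu⟩ := hbf (S x) (hmem x)
    apply lp.ext
    rw [hu x (hS x), hu y (by rw [hxy]; exact hS y)]
  have hrange : Set.range S = ((Submodule.span 𝕜 (Set.range f)).topologicalClosure : Set X) :=
    Set.Subset.antisymm (by rintro _ ⟨x, rfl⟩; exact hmem x) fun s hs => hsp s hs
  obtain ⟨K, hK⟩ := S.antilipschitz_of_injective_of_isClosed_range hinj
    (hrange ▸ Submodule.isClosed_topologicalClosure _)
  -- Adding `1` keeps the constant meaningful when `K = 0`.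
  refine ⟨S, ((K : ℝ) + 1)⁻¹, by positivity, fun n => ?_, fun x => ?_⟩
  · exact tendsto_nhds_unique (hS (stdBasisL2 𝕜 n)) (seriesTendsto_stdBasisL2_coeff f n)
  · have h1 := hK.le_mul_norm (map_zero S) x
    rw [inv_mul_eq_div, div_le_iff₀ (by positivity), mul_comm]
    have := norm_nonneg (S x)
    nlinarith

theorem KEquivalentSeq.exists_bounds {K : ℝ} {f : ℕ → X}
    (h : KEquivalentSeq 𝕜 K f (stdBasisL2 𝕜)) :
    ∃ L : ℝ, 0 < L ∧ ∀ (a : ℕ → 𝕜) (N : ℕ),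
      ‖∑ n ∈ Finset.range N, a n • f n‖ ≤ K * (L * l2Trunc a N) ∧
        L * l2Trunc a N ≤ K * ‖∑ n ∈ Finset.range N, a n • f n‖ := by
  obtain ⟨-, L, hL, h⟩ := h
  refine ⟨L, hL, fun a N => ?_⟩
  let b : ℕ → 𝕜 := fun n => if n < N then a n else 0
  have hb : ∀ n, N ≤ n → b n = 0 := fun n hn => by simp [b, not_lt.2 hn]
  have hba : ∀ n ∈ Finset.range N, b n = a n := fun n hn => by simp [b, Finset.mem_range.1 hn]
  have := h b _ _ (seriesTendsto_of_support b N hb) (seriesTendsto_of_support b N hb)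
  rw [norm_sum_smul_stdBasisL2] at this
  rw [Finset.sum_congr rfl fun n hn => by rw [hba n hn]] at this
  have h2 : l2Trunc b N = l2Trunc a N := by
    unfold l2Trunc
    rw [Finset.sum_congr rfl fun n hn => by rw [hba n hn]]
  rwa [h2] at this

theorem HasL2Bounds.kEquivalentSeq [CompleteSpace X] {K L : ℝ} {f : ℕ → X} (hK : 0 < K)
    (hL : 0 < L) (hf : HasL2Bounds 𝕜 (L / K) (K * L) f) :
    KEquivalentSeq 𝕜 K f (stdBasisL2 𝕜) := by
  refine ⟨hf.equivalentSeq (by positivity) (by positivity), L, hL, fun a s t hs ht => ?_⟩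
  have := hf.seriesTendsto_norm hs ht
  refine ⟨by rw [← mul_assoc]; exact this.2, ?_⟩
  have h1 := this.1
  rw [div_mul_eq_mul_div, div_le_iff₀ hK] at h1
  rwa [mul_comm K]

end L2Bounds

/-! ### Coordinates and finitely supported vectors of `X_{p,w}`. -/

namespace XSpace

variable {𝕜 : Type} [RCLike 𝕜] {p : ℝ≥0∞} {w : ℕ → ℝ}

theorem coord_add (x y : XSpace 𝕜 p w) : (x + y).coord = x.coord + y.coord := rfl

theorem coord_smul (c : 𝕜) (x : XSpace 𝕜 p w) : (c • x).coord = c • x.coord := rfl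

theorem coord_sum {ι : Type*} (s : Finset ι) (x : ι → XSpace 𝕜 p w) (n : ℕ) :
    (∑ i ∈ s, x i).coord n = ∑ i ∈ s, (x i).coord n := by
  classical
  induction s using Finset.induction_on with
  | empty => rfl
  | insert i s hi ih => rw [Finset.sum_insert hi, Finset.sum_insert hi, coord_add, Pi.add_apply, ih]

variable (𝕜 p w) in
/-- The elements of `X_{p,w}` with finitely many nonzero terms. -/
def ofFinset (E : Finset ℕ) (a : ℕ → 𝕜) : XSpace 𝕜 p w :=
  ⟨fun n => if n ∈ E then a n else 0, by
    have h : ∀ (r : ℝ≥0∞) (b : ℕ → 𝕜), Memℓp (fun n => if n ∈ E then b n else 0) r := by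
      intro r b
      refine Memℓp.of_exponent_ge (memℓp_zero ?_) (zero_le)
      refine E.finite_toSet.subset fun n hn => ?_
      by_contra h
      exact hn (if_neg h)
    refine ⟨h p a, ?_⟩
    have h2 := h 2 fun n => (w n : 𝕜) * a n
    have h3 : (fun n => (w n : 𝕜) * if n ∈ E then a n else 0) =
        fun n => if n ∈ E then (w n : 𝕜) * a n else 0 := by
      funext n
      rw [mul_ite, mul_zero]
    rwa [h3]⟩

theorem coord_ofFinset (E : Finset ℕ) (a : ℕ → 𝕜) (n : ℕ) :
    (ofFinset 𝕜 p w E a).coord n = if n ∈ E then a n else 0 := rfl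

section Norm

variable [Fact (1 ≤ p)]

theorem sum_norm_coord_rpow_le (hp : p ≠ ∞) (x : XSpace 𝕜 p w) (E : Finset ℕ) :
    ∑ n ∈ E, ‖x.coord n‖ ^ p.toReal ≤ ‖x‖ ^ p.toReal := by
  have hp0 : 0 < p.toReal :=
    ENNReal.toReal_pos (zero_lt_one.trans_le (Fact.out : 1 ≤ p)).ne' hp
  refine (lp.sum_rpow_le_norm_rpow hp0 (toProd 𝕜 p w x).1 E).trans ?_
  exact Real.rpow_le_rpow (norm_nonneg _) (le_max_left _ _) hp0.le

theorem sum_norm_weight_coord_sq_le (x : XSpace 𝕜 p w) (E : Finset ℕ) :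
    ∑ n ∈ E, ‖(w n : 𝕜) * x.coord n‖ ^ 2 ≤ ‖x‖ ^ 2 := by
  have h := lp.sum_rpow_le_norm_rpow (p := 2) (by norm_num) (toProd 𝕜 p w x).2 E
  simp only [ENNReal.toReal_ofNat, Real.rpow_ofNat] at h
  refine le_trans h ?_
  exact pow_le_pow_left₀ (norm_nonneg _) (le_max_right _ _) 2

variable (𝕜 p w) in
/-- The coordinate functionals of `X_{p,w}`. -/
def coordCLM (n : ℕ) : StrongDual 𝕜 (XSpace 𝕜 p w) :=
  LinearMap.mkContinuous
    { toFun := fun x => x.coord n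
      map_add' := fun _ _ => rfl
      map_smul' := fun _ _ => rfl } 1 fun x => by
    rw [one_mul]
    exact (lp.norm_apply_le_norm (zero_lt_one.trans_le Fact.out).ne'
      (toProd 𝕜 p w x).1 n).trans (le_max_left _ _)

theorem coordCLM_apply (n : ℕ) (x : XSpace 𝕜 p w) : coordCLM 𝕜 p w n x = x.coord n := rfl

end Norm

end XSpace

/-! ### Block vectors and their biorthogonal functionals. -/

section Blocks

variable {𝕜 : Type} [RCLike 𝕜] {p : ℝ≥0∞} {w : ℕ → ℝ}

variable (p w) in
/-- The sum of `w_n ^ (2p / (p - 2))` over a finite set. -/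
def blockSum (E : Finset ℕ) : ℝ := ∑ n ∈ E, w n ^ (2 * p.toReal / (p.toReal - 2))

variable (p w) in
/-- The coefficients `w_n ^ (2 / (p - 2))` of the blocks. -/
def blockCoeff (n : ℕ) : ℝ := w n ^ (2 / (p.toReal - 2))

/-- The exponent `2/(p-2)` is the one that makes `c_n ^ p` and `(w_n c_n) ^ 2` coincide, so both
parts of the norm of a block are powers of the same `blockSum`. -/
theorem blockCoeff_rpow (hw : ∀ n, 0 < w n) (n : ℕ) :
    blockCoeff p w n ^ p.toReal = w n ^ (2 * p.toReal / (p.toReal - 2)) := by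
  rw [blockCoeff, ← Real.rpow_mul (hw n).le]
  congr 1
  ring

theorem weight_mul_blockCoeff_sq (hp2 : 2 < p.toReal) (hw : ∀ n, 0 < w n) (n : ℕ) :
    (w n * blockCoeff p w n) ^ 2 = w n ^ (2 * p.toReal / (p.toReal - 2)) := by
  have h : p.toReal - 2 ≠ 0 := by linarith
  rw [blockCoeff, ← Real.rpow_one_add' (hw n).le, ← Real.rpow_natCast, ← Real.rpow_mul (hw n).le]
  · congr 1
    push_cast
    field_simp
    ring
  · have : 0 < 2 / (p.toReal - 2) := div_pos two_pos (by linarith)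
    positivity

theorem blockCoeff_pos (hw : ∀ n, 0 < w n) (n : ℕ) : 0 < blockCoeff p w n :=
  Real.rpow_pos_of_pos (hw n) _

variable (𝕜 p w) in
/-- The normalized block vector supported on `E`. -/
def blockVector (E : Finset ℕ) : XSpace 𝕜 p w :=
  XSpace.ofFinset 𝕜 p w E fun n => ((blockSum p w E ^ (-(1 / p.toReal)) * blockCoeff p w n : ℝ) : 𝕜)

variable [Fact (1 ≤ p)]

variable (𝕜 p w) in
/-- The functional biorthogonal to the block vector supported on `E`. -/
def blockFunctional (E : Finset ℕ) : StrongDual 𝕜 (XSpace 𝕜 p w) :=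
  ∑ n ∈ E, ((blockSum p w E ^ (1 / p.toReal - 1) * (w n ^ 2 * blockCoeff p w n) : ℝ) : 𝕜) •
    XSpace.coordCLM 𝕜 p w n

theorem blockFunctional_apply (E : Finset ℕ) (x : XSpace 𝕜 p w) :
    blockFunctional 𝕜 p w E x =
      ∑ n ∈ E, ((blockSum p w E ^ (1 / p.toReal - 1) * (w n ^ 2 * blockCoeff p w n) : ℝ) : 𝕜) *
        x.coord n := by
  simp [blockFunctional, XSpace.coordCLM_apply]

theorem blockFunctional_blockVector_self (hp2 : 2 < p.toReal) (hw : ∀ n, 0 < w n) {E : Finset ℕ}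
    (hE : 0 < blockSum p w E) : blockFunctional 𝕜 p w E (blockVector 𝕜 p w E) = 1 := by
  rw [blockFunctional_apply]
  have h : ∀ n ∈ E, ((blockSum p w E ^ (1 / p.toReal - 1) * (w n ^ 2 * blockCoeff p w n) : ℝ) : 𝕜) *
        (blockVector 𝕜 p w E).coord n =
      (((blockSum p w E)⁻¹ * w n ^ (2 * p.toReal / (p.toReal - 2)) : ℝ) : 𝕜) := by
    intro n hn
    rw [blockVector, XSpace.coord_ofFinset, if_pos hn, ← RCLike.ofReal_mul,
      ← weight_mul_blockCoeff_sq hp2 hw]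
    congr 1
    have : (blockSum p w E)⁻¹ = blockSum p w E ^ (1 / p.toReal - 1) *
        blockSum p w E ^ (-(1 / p.toReal)) := by
      rw [← Real.rpow_add hE, ← Real.rpow_neg_one]
      congr 1
      ring
    rw [this]
    ring
  rw [Finset.sum_congr rfl h, ← RCLike.ofReal_sum, ← Finset.mul_sum]
  change (((blockSum p w E)⁻¹ * blockSum p w E : ℝ) : 𝕜) = 1
  rw [inv_mul_cancel₀ hE.ne', RCLike.ofReal_one]

theorem blockFunctional_blockVector_disjoint {E F : Finset ℕ} (h : Disjoint E F) :
    blockFunctional 𝕜 p w E (blockVector 𝕜 p w F) = 0 := by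
  rw [blockFunctional_apply]
  refine Finset.sum_eq_zero fun n hn => ?_
  rw [blockVector, XSpace.coord_ofFinset, if_neg (Finset.disjoint_left.1 h hn), mul_zero]

/-- Hölder against the `ℓ_p` part of the norm: `(2 + 2/(p-2)) · p/(p-1) = 2p/(p-2)`, so the
conjugate norm of the coefficients is again a power of `blockSum` and cancels the normalization. The
bound does not depend on the size of the block. -/
theorem norm_blockFunctional_le (hp : p ≠ ∞) (hp2 : 2 < p.toReal) (hw : ∀ n, 0 < w n)
    {E : Finset ℕ} (hE : 0 < blockSum p w E) : ‖blockFunctional 𝕜 p w E‖ ≤ 1 := by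
  refine ContinuousLinearMap.opNorm_le_bound _ zero_le_one fun x => ?_
  rw [blockFunctional_apply, one_mul]
  set s := p.toReal with hs
  have hs0 : 0 < s := by linarith
  have hconj : s.HolderConjugate (s / (s - 1)) := Real.HolderConjugate.conjExponent (by linarith)
  have hb : ∀ n, 0 ≤ w n ^ 2 * blockCoeff p w n := fun n =>
    mul_nonneg (sq_nonneg _) (blockCoeff_pos hw n).le
  have hpow : ∀ n, (w n ^ 2 * blockCoeff p w n) ^ (s / (s - 1)) =
      w n ^ (2 * s / (s - 2)) := by
    intro n
    have h1 : s - 1 ≠ 0 := by linarith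
    have h2 : s - 2 ≠ 0 := by linarith
    have h3 : w n ^ 2 * blockCoeff p w n = w n ^ (2 + 2 / (s - 2)) := by
      rw [Real.rpow_add (hw n), blockCoeff, Real.rpow_ofNat, hs]
    rw [h3, ← Real.rpow_mul (hw n).le]
    congr 1
    field_simp
    ring
  calc ‖∑ n ∈ E, ((blockSum p w E ^ (1 / s - 1) * (w n ^ 2 * blockCoeff p w n) : ℝ) : 𝕜) *
        x.coord n‖
      ≤ ∑ n ∈ E, blockSum p w E ^ (1 / s - 1) * ((w n ^ 2 * blockCoeff p w n) * ‖x.coord n‖) := by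
        refine norm_sum_le_of_le _ fun n _ => ?_
        rw [norm_mul, RCLike.norm_ofReal, abs_of_nonneg
          (mul_nonneg (Real.rpow_nonneg hE.le _) (hb n)), mul_assoc]
    _ = blockSum p w E ^ (1 / s - 1) * ∑ n ∈ E, ‖x.coord n‖ * (w n ^ 2 * blockCoeff p w n) := by
        rw [Finset.mul_sum]
        exact Finset.sum_congr rfl fun n _ => by ring
    _ ≤ blockSum p w E ^ (1 / s - 1) * ((∑ n ∈ E, ‖x.coord n‖ ^ s) ^ (1 / s) *
          (∑ n ∈ E, (w n ^ 2 * blockCoeff p w n) ^ (s / (s - 1))) ^ (1 / (s / (s - 1)))) := by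
        refine mul_le_mul_of_nonneg_left ?_ (Real.rpow_nonneg hE.le _)
        exact Real.inner_le_Lp_mul_Lq_of_nonneg E hconj (fun _ _ => norm_nonneg _) fun n _ => hb n
    _ ≤ blockSum p w E ^ (1 / s - 1) * (‖x‖ * blockSum p w E ^ (1 / (s / (s - 1)))) := by
        refine mul_le_mul_of_nonneg_left ?_ (Real.rpow_nonneg hE.le _)
        rw [Finset.sum_congr rfl fun n _ => hpow n]
        refine mul_le_mul_of_nonneg_right ?_ (Real.rpow_nonneg hE.le _)
        have := Real.rpow_le_rpow (Finset.sum_nonneg fun n _ => Real.rpow_nonneg (norm_nonneg _) _)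
          (XSpace.sum_norm_coord_rpow_le hp x E) (one_div_nonneg.2 hs0.le)
        rwa [← Real.rpow_mul (norm_nonneg _), mul_one_div_cancel hs0.ne', Real.rpow_one] at this
    _ = ‖x‖ := by
        rw [mul_comm ‖x‖, ← mul_assoc, ← Real.rpow_add hE]
        have : 1 / s - 1 + 1 / (s / (s - 1)) = 0 := by
          have h1 : s - 1 ≠ 0 := by linarith
          field_simp
          ring
        rw [this, Real.rpow_zero, one_mul]

/-- Cauchy–Schwarz against the weighted `ℓ_2` part. The constant is large for small blocks, which is
harmless: it only serves to show equivalence with the `ℓ_2` basis. -/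
theorem norm_blockFunctional_apply_le (hp2 : 2 < p.toReal) (hw : ∀ n, 0 < w n)
    {E : Finset ℕ} (hE : 0 < blockSum p w E) (x : XSpace 𝕜 p w) :
    ‖blockFunctional 𝕜 p w E x‖ ≤
      blockSum p w E ^ (1 / p.toReal - 1 / 2) * √(∑ n ∈ E, ‖(w n : 𝕜) * x.coord n‖ ^ 2) := by
  rw [blockFunctional_apply]
  set s := p.toReal with hs
  have hb : ∀ n, 0 ≤ w n ^ 2 * blockCoeff p w n := fun n =>
    mul_nonneg (sq_nonneg _) (blockCoeff_pos hw n).le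
  calc ‖∑ n ∈ E, ((blockSum p w E ^ (1 / s - 1) * (w n ^ 2 * blockCoeff p w n) : ℝ) : 𝕜) *
        x.coord n‖
      ≤ ∑ n ∈ E, blockSum p w E ^ (1 / s - 1) *
          ((w n * blockCoeff p w n) * ‖(w n : 𝕜) * x.coord n‖) := by
        refine norm_sum_le_of_le _ fun n _ => ?_
        rw [norm_mul, norm_mul, RCLike.norm_ofReal, RCLike.norm_ofReal, abs_of_nonneg
          (mul_nonneg (Real.rpow_nonneg hE.le _) (hb n)), abs_of_pos (hw n)]
        exact le_of_eq (by ring)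
    _ = blockSum p w E ^ (1 / s - 1) *
          ∑ n ∈ E, (w n * blockCoeff p w n) * ‖(w n : 𝕜) * x.coord n‖ := by
        rw [Finset.mul_sum]
    _ ≤ blockSum p w E ^ (1 / s - 1) * (√(∑ n ∈ E, (w n * blockCoeff p w n) ^ 2) *
          √(∑ n ∈ E, ‖(w n : 𝕜) * x.coord n‖ ^ 2)) := by
        refine mul_le_mul_of_nonneg_left ?_ (Real.rpow_nonneg hE.le _)
        exact Real.sum_mul_le_sqrt_mul_sqrt _ _ _
    _ = _ := by
        rw [Finset.sum_congr rfl fun n _ => weight_mul_blockCoeff_sq hp2 hw n]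
        change blockSum p w E ^ (1 / s - 1) * (√(blockSum p w E) * _) = _
        rw [← mul_assoc, Real.sqrt_eq_rpow, ← Real.rpow_add hE]
        congr 2
        ring

theorem norm_sum_smul_blockFunctional_le (hp2 : 2 < p.toReal) (hw : ∀ n, 0 < w n)
    {E : ℕ → Finset ℕ} (hd : Pairwise (Function.onFun Disjoint E)) {M : ℝ}
    (hE : ∀ j, 0 < blockSum p w (E j)) (hM : ∀ j, blockSum p w (E j) ^ (1 / p.toReal - 1 / 2) ≤ M)
    (b : ℕ → 𝕜) (N : ℕ) :
    ‖∑ j ∈ Finset.range N, b j • blockFunctional 𝕜 p w (E j)‖ ≤ M * l2Trunc b N := by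
  have hM0 : 0 ≤ M := (Real.rpow_nonneg (hE 0).le _).trans (hM 0)
  refine ContinuousLinearMap.opNorm_le_bound _ (mul_nonneg hM0 (l2Trunc_nonneg _ _)) fun x => ?_
  rw [sum_apply]
  calc ‖∑ j ∈ Finset.range N, (b j • blockFunctional 𝕜 p w (E j)) x‖
      ≤ ∑ j ∈ Finset.range N, M * (‖b j‖ * √(∑ n ∈ E j, ‖(w n : 𝕜) * x.coord n‖ ^ 2)) := by
        refine norm_sum_le_of_le _ fun j _ => ?_
        rw [smul_apply, norm_smul, mul_left_comm]
        refine mul_le_mul_of_nonneg_left ?_ (norm_nonneg _)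
        refine (norm_blockFunctional_apply_le hp2 hw (hE j) x).trans ?_
        exact mul_le_mul_of_nonneg_right (hM j) (Real.sqrt_nonneg _)
    _ ≤ M * (l2Trunc b N * √(∑ j ∈ Finset.range N,
          √(∑ n ∈ E j, ‖(w n : 𝕜) * x.coord n‖ ^ 2) ^ 2)) := by
        rw [← Finset.mul_sum]
        exact mul_le_mul_of_nonneg_left (Real.sum_mul_le_sqrt_mul_sqrt _ _ _) hM0
    _ ≤ M * (l2Trunc b N * ‖x‖) := by
        refine mul_le_mul_of_nonneg_left ?_ hM0
        refine mul_le_mul_of_nonneg_left ?_ (l2Trunc_nonneg _ _)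
        refine Real.sqrt_le_iff.2 ⟨norm_nonneg _, ?_⟩
        rw [Finset.sum_congr rfl fun j _ =>
          Real.sq_sqrt (Finset.sum_nonneg fun n _ => sq_nonneg ‖(w n : 𝕜) * x.coord n‖)]
        rw [← Finset.sum_biUnion fun i _ j _ hij => hd hij]
        exact XSpace.sum_norm_weight_coord_sq_le x _
    _ = _ := by ring

/-- By disjointness the blocks behave like the unit vectors of a space of the same type, with
weights `blockSum ^ (1/2 - 1/p)` in place of `w`. -/
theorem norm_sum_smul_blockVector_le (hp : p ≠ ∞) (hp2 : 2 < p.toReal) (hw : ∀ n, 0 < w n)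
    {E : ℕ → Finset ℕ} (hd : Pairwise (Function.onFun Disjoint E)) {V : ℝ}
    (hE : ∀ j, 0 < blockSum p w (E j)) (hV : ∀ j, blockSum p w (E j) ^ (1 / 2 - 1 / p.toReal) ≤ V)
    (a : ℕ → 𝕜) (N : ℕ) :
    ‖∑ j ∈ Finset.range N, a j • blockVector 𝕜 p w (E j)‖ ≤
      max ((∑ j ∈ Finset.range N, ‖a j‖ ^ p.toReal) ^ (1 / p.toReal)) (V * l2Trunc a N) := by
  set s := p.toReal with hs
  have hs0 : 0 < s := by linarith
  have hV0 : 0 ≤ V := (Real.rpow_nonneg (hE 0).le _).trans (hV 0)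
  set z := ∑ j ∈ Finset.range N, a j • blockVector 𝕜 p w (E j) with hz
  have hcoord : ∀ j ∈ Finset.range N, ∀ n ∈ E j, ‖z.coord n‖ =
      ‖a j‖ * (blockSum p w (E j) ^ (-(1 / s)) * blockCoeff p w n) := by
    intro j hj n hn
    rw [hz, XSpace.coord_sum, Finset.sum_eq_single j]
    · rw [XSpace.coord_smul, Pi.smul_apply, blockVector, XSpace.coord_ofFinset, if_pos hn, norm_smul,
        RCLike.norm_ofReal, abs_of_nonneg
          (mul_nonneg (Real.rpow_nonneg (hE j).le _) (blockCoeff_pos hw n).le)]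
    · intro i _ hij
      rw [XSpace.coord_smul, Pi.smul_apply, blockVector, XSpace.coord_ofFinset, if_neg, smul_zero]
      exact Finset.disjoint_right.1 (hd hij) hn
    · intro h; exact absurd hj h
  have hcoord0 : ∀ n ∉ (Finset.range N).biUnion E, z.coord n = 0 := by
    intro n hn
    rw [hz, XSpace.coord_sum]
    refine Finset.sum_eq_zero fun j hj => ?_
    rw [XSpace.coord_smul, Pi.smul_apply, blockVector, XSpace.coord_ofFinset, if_neg, smul_zero]
    exact fun h => hn (Finset.mem_biUnion.2 ⟨j, hj, h⟩)
  rw [XSpace.norm_eq hp]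
  refine max_le_max ?_ ?_
  · refine le_of_eq ?_
    congr 1
    rw [tsum_eq_sum (s := (Finset.range N).biUnion E) fun n hn => by
      rw [hcoord0 n hn, norm_zero, Real.zero_rpow hs0.ne'],
      Finset.sum_biUnion fun i _ j _ hij => hd hij]
    refine Finset.sum_congr rfl fun j hj => ?_
    have hβ := Real.rpow_nonneg (hE j).le (-(1 / s))
    have : ∀ n ∈ E j, ‖z.coord n‖ ^ s =
        ‖a j‖ ^ s * (blockSum p w (E j))⁻¹ * w n ^ (2 * s / (s - 2)) := by
      intro n hn
      rw [hcoord j hj n hn, Real.mul_rpow (norm_nonneg _)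
        (mul_nonneg hβ (blockCoeff_pos hw n).le), Real.mul_rpow hβ (blockCoeff_pos hw n).le,
        blockCoeff_rpow hw, ← Real.rpow_mul (hE j).le, neg_mul, one_div_mul_cancel hs0.ne',
        Real.rpow_neg_one, mul_assoc]
    rw [Finset.sum_congr rfl this, ← Finset.mul_sum]
    change ‖a j‖ ^ s * (blockSum p w (E j))⁻¹ * blockSum p w (E j) = _
    rw [mul_assoc, inv_mul_cancel₀ (hE j).ne', mul_one]
  · rw [← Real.sqrt_eq_rpow]
    refine Real.sqrt_le_iff.2 ⟨mul_nonneg hV0 (l2Trunc_nonneg _ _), ?_⟩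
    rw [mul_pow, l2Trunc_sq]
    simp only [Real.rpow_ofNat]
    rw [tsum_eq_sum (s := (Finset.range N).biUnion E) fun n hn => by
      rw [hcoord0 n hn, mul_zero, norm_zero, zero_pow two_ne_zero],
      Finset.sum_biUnion fun i _ j _ hij => hd hij, Finset.mul_sum]
    refine Finset.sum_le_sum fun j hj => ?_
    have : ∀ n ∈ E j, ‖(w n : 𝕜) * z.coord n‖ ^ 2 =
        ‖a j‖ ^ 2 * (blockSum p w (E j) ^ (-(1 / s))) ^ 2 * w n ^ (2 * s / (s - 2)) := by
      intro n hn
      rw [norm_mul, hcoord j hj n hn, ← weight_mul_blockCoeff_sq hp2 hw, RCLike.norm_ofReal,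
        abs_of_pos (hw n)]
      ring
    rw [Finset.sum_congr rfl this, ← Finset.mul_sum]
    change ‖a j‖ ^ 2 * (blockSum p w (E j) ^ (-(1 / s))) ^ 2 * blockSum p w (E j) ≤ _
    have h2 : (blockSum p w (E j) ^ (-(1 / s))) ^ 2 * blockSum p w (E j) =
        (blockSum p w (E j) ^ (1 / 2 - 1 / s)) ^ 2 := by
      rw [← Real.rpow_mul_natCast (hE j).le, ← Real.rpow_mul_natCast (hE j).le,
        ← Real.rpow_add_one (hE j).ne']
      congr 1
      push_cast
      ring
    rw [mul_assoc, h2, mul_comm]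
    refine mul_le_mul_of_nonneg_right ?_ (sq_nonneg _)
    exact pow_le_pow_left₀ (Real.rpow_nonneg (hE j).le _) (hV j) 2

end Blocks

/-- Terms are added one at a time until the sum reaches `b`; the last one overshoots by at most `b`.
-/
theorem Finset.exists_subset_sum_mem_Icc {ι : Type*} [DecidableEq ι] {f : ι → ℝ} {b : ℝ} (hb : 0 ≤ b)
    (s : Finset ι) (hf : ∀ i ∈ s, f i ≤ b) (hs : b ≤ ∑ i ∈ s, f i) :
    ∃ t ⊆ s, b ≤ ∑ i ∈ t, f i ∧ ∑ i ∈ t, f i ≤ 2 * b := by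
  induction s using Finset.induction_on with
  | empty => exact ⟨∅, le_rfl, hs, by simpa using hb⟩
  | insert i s hi ih =>
    rcases le_or_gt b (∑ i ∈ s, f i) with h | h
    · obtain ⟨t, ht, h1⟩ := ih (fun j hj => hf j (Finset.mem_insert_of_mem hj)) h
      exact ⟨t, ht.trans (Finset.subset_insert _ _), h1⟩
    · refine ⟨insert i s, le_rfl, hs, ?_⟩
      rw [Finset.sum_insert hi]
      linarith [hf i (Finset.mem_insert_self _ _)]

/-! ### Disjoint blocks of prescribed size. -/

section Selection

variable {p : ℝ≥0∞} {w : ℕ → ℝ}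

theorem ConditionStar.exists_block (hstar : ConditionStar p w) (hp2 : 2 < p.toReal)
    (hw : ∀ n, 0 < w n) {b : ℝ} (hb : 0 < b) (F : Finset ℕ) :
    ∃ E : Finset ℕ, Disjoint F E ∧ b ≤ blockSum p w E ∧ blockSum p w E ≤ 2 * b := by
  classical
  set t := 2 * p.toReal / (p.toReal - 2) with ht
  have ht0 : 0 < t := div_pos (by linarith) (by linarith)
  -- A weight below this threshold contributes at most `b` to the block sum.
  set ε := b ^ t⁻¹ with hε
  have hε0 : 0 < ε := Real.rpow_pos_of_pos hb _
  set f : ℕ → ℝ := Set.indicator {n | w n < ε} fun n => w n ^ t with hf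
  have hf0 : ∀ n, 0 ≤ f n := fun n => Set.indicator_nonneg (fun n _ => Real.rpow_nonneg (hw n).le _) n
  have hns : ¬ Summable f := fun h => hstar ε hε0 (summable_subtype_iff_indicator.2 h)
  -- Divergence leaves more than `b` even after the already used indices `F` are discarded.
  have hbig : ∃ u : Finset ℕ, b + ∑ n ∈ F, f n < ∑ n ∈ u, f n := by
    by_contra! h
    exact hns (summable_of_sum_le hf0 h)
  obtain ⟨u, hu⟩ := hbig
  set s := (u \ F).filter fun n => w n < ε with hs
  have hsum : b ≤ ∑ n ∈ s, w n ^ t := by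
    have h1 : ∑ n ∈ s, w n ^ t = ∑ n ∈ u \ F, f n := by
      rw [hs, Finset.sum_filter]
      refine Finset.sum_congr rfl fun n _ => ?_
      simp [hf, Set.indicator_apply]
    rw [h1]
    have h2 : ∑ n ∈ u, f n ≤ ∑ n ∈ u \ F, f n + ∑ n ∈ F, f n := by
      rw [← Finset.sum_inter_add_sum_sdiff u F, add_comm]
      gcongr
      · intro n _ _; exact hf0 n
      · exact Finset.inter_subset_right
    linarith
  have hle : ∀ n ∈ s, w n ^ t ≤ b := by
    intro n hn
    have h1 : w n ≤ ε := (Finset.mem_filter.1 hn).2.le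
    have h2 := Real.rpow_le_rpow (hw n).le h1 ht0.le
    rwa [hε, ← Real.rpow_mul hb.le, inv_mul_cancel₀ ht0.ne', Real.rpow_one] at h2
  obtain ⟨E, hE, h1, h2⟩ := s.exists_subset_sum_mem_Icc hb.le hle hsum
  refine ⟨E, ?_, h1, h2⟩
  refine Finset.disjoint_right.2 fun n hn => ?_
  exact (Finset.mem_sdiff.1 (Finset.mem_filter.1 (hE hn)).1).2

theorem ConditionStar.exists_blocks (hstar : ConditionStar p w) (hp2 : 2 < p.toReal)
    (hw : ∀ n, 0 < w n) {b : ℝ} (hb : 0 < b) :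
    ∃ E : ℕ → Finset ℕ, Pairwise (Function.onFun Disjoint E) ∧
      ∀ j, b ≤ blockSum p w (E j) ∧ blockSum p w (E j) ≤ 2 * b := by
  classical
  obtain ⟨E, hE, hd⟩ := exists_seq_of_forall_finset_exists
    (fun E : Finset ℕ => b ≤ blockSum p w E ∧ blockSum p w E ≤ 2 * b) (fun E F => Disjoint E F)
    fun s _ => by
      obtain ⟨E, h1, h2⟩ := hstar.exists_block hp2 hw hb (s.biUnion id)
      exact ⟨E, h2, fun F hF => h1.mono_left (Finset.subset_biUnion_of_mem id hF)⟩
  refine ⟨E, fun i j hij => ?_, hE⟩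
  rcases hij.lt_or_gt with h | h
  · exact hd _ _ h
  · exact (hd _ _ h).symm

end Selection

/-! ### Failure of `P₂` for the dual of `X_{p,w}`. -/

section DualFails

variable {𝕜 : Type} [RCLike 𝕜] {p : ℝ≥0∞} [Fact (1 ≤ p)] {w : ℕ → ℝ}

theorem l2Trunc_one (N : ℕ) : l2Trunc (fun _ => (1 : 𝕜)) N = √N := by
  simp [l2Trunc]

theorem sum_norm_rpow_le_l2Trunc {s : ℝ} (hs : 2 ≤ s) (a : ℕ → 𝕜) (N : ℕ) :
    (∑ j ∈ Finset.range N, ‖a j‖ ^ s) ^ (1 / s) ≤ l2Trunc a N := by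
  have hs0 : 0 < s := by linarith
  rw [← Real.rpow_le_rpow_iff (z := s) (by positivity) (l2Trunc_nonneg _ _) hs0,
    ← Real.rpow_mul (by positivity), one_div_mul_cancel hs0.ne', Real.rpow_one]
  have h1 : l2Trunc a N ^ s = ∑ j ∈ Finset.range N, l2Trunc a N ^ (s - 2) * ‖a j‖ ^ 2 := by
    rw [← Finset.mul_sum, ← l2Trunc_sq, ← Real.rpow_natCast, ← Real.rpow_add' (l2Trunc_nonneg _ _)]
    · congr 1; push_cast; ring
    · push_cast; linarith
  rw [h1]
  refine Finset.sum_le_sum fun j hj => ?_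
  have h2 : ‖a j‖ ^ s = ‖a j‖ ^ (s - 2) * ‖a j‖ ^ 2 := by
    rw [← Real.rpow_natCast, ← Real.rpow_add' (norm_nonneg _)]
    · congr 1; push_cast; ring
    · push_cast; linarith
  rw [h2]
  gcongr
  exact norm_le_l2Trunc a (Finset.mem_range.1 hj)

/-- The action of a combination of block functionals on the matching combination of block
vectors. -/
theorem sum_blockFunctional_sum_blockVector (hp2 : 2 < p.toReal) (hw : ∀ n, 0 < w n)
    {E : ℕ → Finset ℕ} (hd : Pairwise (Function.onFun Disjoint E))
    (hE : ∀ j, 0 < blockSum p w (E j)) (a b : ℕ → 𝕜) (N : ℕ) :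
    (∑ j ∈ Finset.range N, b j • blockFunctional 𝕜 p w (E j))
      (∑ j ∈ Finset.range N, a j • blockVector 𝕜 p w (E j)) =
        ∑ j ∈ Finset.range N, b j * a j := by
  rw [sum_apply]
  refine Finset.sum_congr rfl fun j hj => ?_
  rw [smul_apply, map_sum, Finset.sum_eq_single j]
  · rw [map_smul, blockFunctional_blockVector_self hp2 hw (hE j), smul_eq_mul, smul_eq_mul, mul_one]
  · intro i _ hij
    rw [map_smul, blockFunctional_blockVector_disjoint (hd hij.symm), smul_zero]
  · intro h; exact absurd hj h

/-- Pairing with the block vectors carrying the conjugate coefficients gives the squared `ℓ_2` norm,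
and that combination has norm at most the `ℓ_2` norm because `p ≥ 2` and the block weights are at
most `1`. -/
theorem l2Trunc_le_norm_sum_smul_blockFunctional (hp : p ≠ ∞) (hp2 : 2 < p.toReal)
    (hw : ∀ n, 0 < w n) {E : ℕ → Finset ℕ} (hd : Pairwise (Function.onFun Disjoint E))
    (hE : ∀ j, 0 < blockSum p w (E j))
    (hV : ∀ j, blockSum p w (E j) ^ (1 / 2 - 1 / p.toReal) ≤ 1) (b : ℕ → 𝕜) (N : ℕ) :
    l2Trunc b N ≤ ‖∑ j ∈ Finset.range N, b j • blockFunctional 𝕜 p w (E j)‖ := by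
  set a : ℕ → 𝕜 := fun j => starRingEnd 𝕜 (b j) with ha
  have hab : l2Trunc a N = l2Trunc b N := by simp [l2Trunc, ha]
  have h1 := (∑ j ∈ Finset.range N, b j • blockFunctional 𝕜 p w (E j)).le_opNorm
    (∑ j ∈ Finset.range N, a j • blockVector 𝕜 p w (E j))
  rw [sum_blockFunctional_sum_blockVector hp2 hw hd hE] at h1
  have h2 : ‖∑ j ∈ Finset.range N, b j * a j‖ = l2Trunc b N ^ 2 := by
    have : ∑ j ∈ Finset.range N, b j * a j = ((l2Trunc b N ^ 2 : ℝ) : 𝕜) := by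
      rw [l2Trunc_sq]
      push_cast
      exact Finset.sum_congr rfl fun j _ => RCLike.mul_conj (b j)
    rw [this, RCLike.norm_ofReal, abs_of_nonneg (sq_nonneg _)]
  have h3 : ‖∑ j ∈ Finset.range N, a j • blockVector 𝕜 p w (E j)‖ ≤ l2Trunc b N := by
    refine (norm_sum_smul_blockVector_le hp hp2 hw hd hE hV a N).trans ?_
    rw [one_mul, ← hab]
    exact max_le (sum_norm_rpow_le_l2Trunc hp2.le a N) le_rfl
  rw [h2] at h1
  rcases (l2Trunc_nonneg b N).eq_or_lt with h0 | h0
  · rw [← h0]; exact norm_nonneg _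
  · refine le_of_mul_le_mul_right ?_ h0
    rw [← pow_two]
    exact h1.trans (mul_le_mul_of_nonneg_left h3 (norm_nonneg _))

/-- The sum of `N` block vectors has norm at most `max (N^{1/p}) (V√N)`. For large `N` the second
term dominates since `p > 2`, and pairing with the sum of `N` functionals gives `N`. -/
theorem exists_sqrt_le_norm_sum_blockFunctional (hp : p ≠ ∞) (hp2 : 2 < p.toReal)
    (hw : ∀ n, 0 < w n) {E : ℕ → Finset ℕ} (hd : Pairwise (Function.onFun Disjoint E))
    (hE : ∀ j, 0 < blockSum p w (E j)) {V : ℝ} (hV0 : 0 < V)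
    (hV : ∀ j, blockSum p w (E j) ^ (1 / 2 - 1 / p.toReal) ≤ V) :
    ∃ N : ℕ, 0 < N ∧
      √N ≤ V * ‖∑ j ∈ Finset.range N, (1 : 𝕜) • blockFunctional 𝕜 p w (E j)‖ := by
  set s := p.toReal with hs
  have hs0 : 0 < s := by linarith
  have hexp : 0 < 1 / 2 - 1 / s := by
    rw [sub_pos]; exact one_div_lt_one_div_of_lt two_pos hp2
  have hlim : Tendsto (fun N : ℕ => V * (N : ℝ) ^ (1 / 2 - 1 / s)) atTop atTop :=
    ((tendsto_rpow_atTop hexp).comp tendsto_natCast_atTop_atTop).const_mul_atTop hV0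
  obtain ⟨N, hN1, hN0⟩ := ((hlim.eventually_ge_atTop 1).and (eventually_gt_atTop 0)).exists
  refine ⟨N, hN0, ?_⟩
  have hNpos : (0 : ℝ) < N := by exact_mod_cast hN0
  have h1 := (∑ j ∈ Finset.range N, (1 : 𝕜) • blockFunctional 𝕜 p w (E j)).le_opNorm
    (∑ j ∈ Finset.range N, (1 : 𝕜) • blockVector 𝕜 p w (E j))
  have h0 := sum_blockFunctional_sum_blockVector (𝕜 := 𝕜) hp2 hw hd hE (fun _ => 1) (fun _ => 1) N
  simp only [mul_one, Finset.sum_const, Finset.card_range, nsmul_eq_mul] at h0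
  rw [h0, RCLike.norm_natCast] at h1
  have h3 : ‖∑ j ∈ Finset.range N, (1 : 𝕜) • blockVector 𝕜 p w (E j)‖ ≤ V * √N := by
    refine (norm_sum_smul_blockVector_le hp hp2 hw hd hE hV (fun _ => 1) N).trans ?_
    rw [l2Trunc_one]
    refine max_le ?_ le_rfl
    simp only [norm_one, Real.one_rpow, Finset.sum_const, Finset.card_range, nsmul_eq_mul, mul_one]
    calc (N : ℝ) ^ (1 / s) = 1 * (N : ℝ) ^ (1 / s) := (one_mul _).symm
      _ ≤ (V * (N : ℝ) ^ (1 / 2 - 1 / s)) * (N : ℝ) ^ (1 / s) := by gcongr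
      _ = V * √N := by
        rw [mul_assoc, ← Real.rpow_add hNpos, sub_add_cancel, Real.sqrt_eq_rpow]
  have h4 := h1.trans (mul_le_mul_of_nonneg_left h3 (norm_nonneg _))
  have hsq : (N : ℝ) = √N * √N := (Real.mul_self_sqrt hNpos.le).symm
  have hsp : 0 < √(N : ℝ) := Real.sqrt_pos.2 hNpos
  refine le_of_mul_le_mul_right ?_ hsp
  calc √N * √N = N := hsq.symm
    _ ≤ _ := h4
    _ = _ := by ring

/-- No Banach space containing an isomorphic copy of `X_{p,w}^*` satisfies `P₂`. -/
theorem not_propertyP2_of_embedding (hp : p ≠ ∞) (hp2 : 2 < p.toReal) (hw : ∀ n, 0 < w n)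
    (hstar : ConditionStar p w) {Z : Type*} [NormedAddCommGroup Z] [NormedSpace 𝕜 Z]
    [CompleteSpace Z] (J : StrongDual 𝕜 (XSpace 𝕜 p w) →L[𝕜] Z) {c : ℝ} (hc : 0 < c)
    (hJ : ∀ x, c * ‖x‖ ≤ ‖J x‖) : ¬ PropertyP2 𝕜 Z := by
  intro hP
  set s := p.toReal with hs
  have hexp : 0 < 1 / 2 - 1 / s := by
    rw [sub_pos]; exact one_div_lt_one_div_of_lt two_pos hp2
  set D := ‖J‖ + 1 with hD
  have hD0 : 0 < D := by positivity
  -- `V ≤ 1` gives the lower `ℓ_2` estimate; `8DV ≤ c` defeats `2`-equivalence after the distortion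
  -- by `J`.
  set V := min 1 (c / (8 * D)) with hVdef
  have hV0 : 0 < V := lt_min one_pos (by positivity)
  -- Block sums in `[b, 2b]` then have block weights at most `V`.
  set b := V ^ (1 / 2 - 1 / s)⁻¹ / 2 with hbdef
  have hb0 : 0 < b := by positivity
  obtain ⟨E, hd, hE⟩ := hstar.exists_blocks hp2 hw hb0
  have hEpos : ∀ j, 0 < blockSum p w (E j) := fun j => hb0.trans_le (hE j).1
  have hEV : ∀ j, blockSum p w (E j) ^ (1 / 2 - 1 / s) ≤ V := by
    intro j
    have h1 : blockSum p w (E j) ≤ V ^ (1 / 2 - 1 / s)⁻¹ := by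
      have := (hE j).2; rw [hbdef] at this; linarith
    have h2 := Real.rpow_le_rpow (hEpos j).le h1 hexp.le
    rwa [← Real.rpow_mul hV0.le, inv_mul_cancel₀ hexp.ne', Real.rpow_one] at h2
  have hEM : ∀ j, blockSum p w (E j) ^ (1 / s - 1 / 2) ≤ b ^ (1 / s - 1 / 2) := fun j =>
    Real.rpow_le_rpow_of_nonpos hb0 (hE j).1 (by linarith)
  set f : ℕ → Z := fun j => J (blockFunctional 𝕜 p w (E j)) with hf
  have hsum : ∀ (φ : ℕ → ℕ) (a : ℕ → 𝕜) (N : ℕ), ∑ j ∈ Finset.range N, a j • f (φ j) =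
      J (∑ j ∈ Finset.range N, a j • blockFunctional 𝕜 p w (E (φ j))) := by
    intro φ a N
    simp [hf, map_sum]
  have hbounds : HasL2Bounds 𝕜 c (D * b ^ (1 / s - 1 / 2)) f := by
    intro a N
    have h := hsum id a N
    simp only [id] at h
    rw [h]
    constructor
    · refine le_trans ?_ (hJ _)
      gcongr
      exact l2Trunc_le_norm_sum_smul_blockFunctional hp hp2 hw hd hEpos
        (fun j => (hEV j).trans (min_le_left _ _)) a N
    · refine (J.le_opNorm _).trans ?_
      rw [mul_assoc]
      have := norm_sum_smul_blockFunctional_le hp2 hw hd hEpos hEM a N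
      gcongr
      rw [hD]; linarith
  obtain ⟨φ, hφ, hK⟩ := hP 1 one_pos f (hbounds.equivalentSeq hc (by positivity))
  obtain ⟨L, hL, hb⟩ := hK.exists_bounds
  have hd' : Pairwise (Function.onFun Disjoint fun j => E (φ j)) :=
    fun i j hij => hd (hφ.injective.ne hij)
  obtain ⟨N, hN0, hN⟩ := exists_sqrt_le_norm_sum_blockFunctional (𝕜 := 𝕜) hp hp2 hw hd'
    (fun j => hEpos (φ j)) hV0 fun j => hEV (φ j)
  -- A single functional has norm at most `1`, which bounds the scale `L` independently of `V`.
  have hL1 : L ≤ 2 * D := by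
    have h1 := (hb (fun _ => 1) 1).2
    rw [l2Trunc_one] at h1
    simp only [Finset.sum_range_one, one_smul, Nat.cast_one, Real.sqrt_one, mul_one,
      Function.comp_apply] at h1
    have h2 : ‖f (φ 0)‖ ≤ D := by
      refine (J.le_opNorm _).trans ?_
      have := norm_blockFunctional_le (𝕜 := 𝕜) hp hp2 hw (hEpos (φ 0))
      have h3 := norm_nonneg J
      calc ‖J‖ * ‖blockFunctional 𝕜 p w (E (φ 0))‖ ≤ ‖J‖ * 1 := by gcongr
        _ ≤ D := by rw [hD]; linarith
    linarith
  have h1 := (hb (fun _ => 1) N).1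
  rw [l2Trunc_one] at h1
  have h2 := hJ (∑ j ∈ Finset.range N, (1 : 𝕜) • blockFunctional 𝕜 p w (E (φ j)))
  have h3 := hsum φ (fun _ => 1) N
  rw [← h3] at h2
  have h4 := h2.trans h1
  have hsp : 0 < √(N : ℝ) := Real.sqrt_pos.2 (by exact_mod_cast hN0)
  set G := ‖∑ j ∈ Finset.range N, (1 : 𝕜) • blockFunctional 𝕜 p w (E (φ j))‖ with hG
  have h5 : c * √(N : ℝ) ≤ V * (4 * D * √N) * 1 := by
    calc c * √(N : ℝ) ≤ c * (V * G) := by gcongr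
      _ = V * (c * G) := by ring
      _ ≤ V * ((1 + 1) * (L * √N)) := by gcongr
      _ ≤ V * ((1 + 1) * (2 * D * √N)) := by gcongr
      _ = _ := by ring
  have h6 : V * (8 * D) ≤ c := by
    rw [← le_div_iff₀ (by positivity)]; exact min_le_right _ _
  have h7 : c * √(N : ℝ) ≤ c / 2 * √N := by
    calc c * √(N : ℝ) ≤ V * (8 * D) / 2 * √N := by linarith
      _ ≤ c / 2 * √N := by gcongr
  have := mul_pos hc hsp
  linarith

end DualFails

/-- The contradiction that closes both hump arguments below. -/
theorem not_forall_natCast_mul_le {η C α : ℝ} (hη : 0 < η) (hα : α < 1) :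
    ¬ ∀ N : ℕ, (N : ℝ) * η ≤ C * (N : ℝ) ^ α := by
  intro h
  have hlim : Tendsto (fun N : ℕ => η * (N : ℝ) ^ (1 - α)) atTop atTop :=
    ((tendsto_rpow_atTop (by linarith)).comp tendsto_natCast_atTop_atTop).const_mul_atTop hη
  obtain ⟨N, hN1, hN0⟩ := ((hlim.eventually_gt_atTop C).and (eventually_gt_atTop 0)).exists
  have hNpos : (0 : ℝ) < N := by exact_mod_cast hN0
  have h1 : C * (N : ℝ) ^ α < η * (N : ℝ) ^ (1 - α) * (N : ℝ) ^ α := by gcongr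
  rw [mul_assoc, ← Real.rpow_add hNpos, sub_add_cancel, Real.rpow_one] at h1
  linarith [h N]

/-! ### Truncations in vector-valued `ℓ_q` and a form of Pitt's theorem. -/

section Truncation

variable {𝕜 : Type*} [RCLike 𝕜] {E : ℕ → Type*} [∀ i, NormedAddCommGroup (E i)]
  {q : ℝ≥0∞}

theorem lp.norm_add_rpow_of_disjoint (hq : 0 < q.toReal) {x y : lp E q}
    (h : ∀ i, x i = 0 ∨ y i = 0) :
    ‖x + y‖ ^ q.toReal = ‖x‖ ^ q.toReal + ‖y‖ ^ q.toReal := by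
  refine (lp.hasSum_norm hq (x + y)).unique ?_
  refine ((lp.hasSum_norm hq x).add (lp.hasSum_norm hq y)).congr_fun ?_
  intro i
  rw [lp.coeFn_add, Pi.add_apply]
  rcases h i with h | h <;> simp [h, Real.zero_rpow hq.ne']

variable [∀ i, NormedSpace 𝕜 (E i)] [Fact (1 ≤ q)]

variable (𝕜 E q) in
/-- The projection of `lp E q` onto the first `k` coordinates. -/
def lp.truncCLM (k : ℕ) : lp E q →L[𝕜] lp E q :=
  ∑ j ∈ Finset.range k, (lp.singleContinuousLinearMap 𝕜 E q j) ∘L (lp.evalCLM 𝕜 E q j)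

theorem lp.truncCLM_eq_sum (k : ℕ) (z : lp E q) :
    lp.truncCLM 𝕜 E q k z = ∑ j ∈ Finset.range k, lp.single q j (z j) := by
  rw [lp.truncCLM, sum_apply]
  rfl

theorem lp.truncCLM_apply (k : ℕ) (z : lp E q) (i : ℕ) :
    lp.truncCLM 𝕜 E q k z i = if i < k then z i else 0 := by
  rw [lp.truncCLM_eq_sum, lp.coeFn_sum, Finset.sum_apply]
  split_ifs with h
  · rw [Finset.sum_eq_single i, lp.single_apply_self]
    · intro j _ hj; exact lp.single_apply_ne _ _ _ hj.symm
    · intro h'; exact absurd (Finset.mem_range.2 h) h'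
  · refine Finset.sum_eq_zero fun j hj => lp.single_apply_ne _ _ _ ?_
    rintro rfl
    exact h (Finset.mem_range.1 hj)

theorem lp.tendsto_truncCLM (hq : q ≠ ∞) (z : lp E q) :
    Tendsto (fun k => lp.truncCLM 𝕜 E q k z) atTop (𝓝 z) := by
  simp only [lp.truncCLM_eq_sum]
  exact (lp.hasSum_single hq z).tendsto_sum_nat

theorem lp.norm_truncCLM_add (hq : 0 < q.toReal) (k : ℕ) (z : lp E q) :
    ‖lp.truncCLM 𝕜 E q k z‖ ^ q.toReal + ‖z - lp.truncCLM 𝕜 E q k z‖ ^ q.toReal =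
      ‖z‖ ^ q.toReal := by
  rw [← lp.norm_add_rpow_of_disjoint hq, add_sub_cancel]
  intro i
  rw [lp.coeFn_sub, Pi.sub_apply, lp.truncCLM_apply]
  split_ifs with h
  · right; simp
  · left; rfl

theorem lp.norm_truncCLM_le (hq : 0 < q.toReal) (k : ℕ) (z : lp E q) :
    ‖lp.truncCLM 𝕜 E q k z‖ ≤ ‖z‖ := by
  rw [← Real.rpow_le_rpow_iff (norm_nonneg _) (norm_nonneg _) hq,
    ← lp.norm_truncCLM_add (𝕜 := 𝕜) hq k z]
  exact le_add_of_nonneg_right (Real.rpow_nonneg (norm_nonneg _) _)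

theorem lp.norm_sub_truncCLM_le (hq : 0 < q.toReal) (k : ℕ) (z : lp E q) :
    ‖z - lp.truncCLM 𝕜 E q k z‖ ≤ ‖z‖ := by
  rw [← Real.rpow_le_rpow_iff (norm_nonneg _) (norm_nonneg _) hq,
    ← lp.norm_truncCLM_add (𝕜 := 𝕜) hq k z]
  exact le_add_of_nonneg_left (Real.rpow_nonneg (norm_nonneg _) _)

/-- A functional on `lp E q`, `1 < q < ∞`, is small on vectors supported far out. -/
theorem lp.exists_norm_apply_sub_truncCLM_le (hq : q ≠ ∞) (hq1 : 1 < q.toReal)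
    (u : StrongDual 𝕜 (lp E q)) {η : ℝ} (hη : 0 < η) :
    ∃ k, ∀ z, ‖u (z - lp.truncCLM 𝕜 E q k z)‖ ≤ η * ‖z‖ := by
  by_contra! hcon
  have hq0 : 0 < q.toReal := by linarith
  have hunit : ∀ k, ∃ y : lp E q, ‖y‖ ≤ 1 ∧ η < ‖u (y - lp.truncCLM 𝕜 E q k y)‖ := by
    intro k
    obtain ⟨z, hz⟩ := hcon k
    have hz0 : 0 < ‖z‖ := by
      rcases (norm_nonneg z).eq_or_lt with h | h
      · rw [eq_comm, norm_eq_zero] at h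
        simp [h] at hz
      · exact h
    refine ⟨((‖z‖⁻¹ : ℝ) : 𝕜) • z, ?_, ?_⟩
    · rw [norm_smul, RCLike.norm_ofReal, abs_of_pos (inv_pos.2 hz0), inv_mul_cancel₀ hz0.ne']
    · rw [map_smul, ← smul_sub, map_smul, norm_smul, RCLike.norm_ofReal,
        abs_of_pos (inv_pos.2 hz0), inv_mul_eq_div, lt_div_iff₀ hz0]
      exact hz
  -- Gliding hump: `N` disjointly supported vectors of norm at most `1`, each contributing at least
  -- `η` to `u`. Then `N η ≤ ‖u‖ N^{1/q}`, impossible for large `N` as `q > 1`.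
  have key : ∀ N : ℕ, ∃ (z : lp E q) (m : ℕ), (∀ i, m ≤ i → z i = 0) ∧
      ‖z‖ ^ q.toReal ≤ N ∧ N * η ≤ RCLike.re (u z) := by
    intro N
    induction N with
    | zero => exact ⟨0, 0, fun _ _ => rfl, by simp [Real.zero_rpow hq0.ne'], by simp⟩
    | succ N ih =>
      obtain ⟨z, m, hz0, hz1, hz2⟩ := ih
      obtain ⟨y, hy1, hy2⟩ := hunit m
      set v := y - lp.truncCLM 𝕜 E q m y with hv
      have hlim : Tendsto (fun k => ‖u (lp.truncCLM 𝕜 E q k v)‖) atTop (𝓝 ‖u v‖) :=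
        ((u.continuous.tendsto v).comp (lp.tendsto_truncCLM hq v)).norm
      obtain ⟨k, hk, hmk⟩ := ((hlim.eventually (lt_mem_nhds hy2)).and (eventually_ge_atTop m)).exists
      set x := lp.truncCLM 𝕜 E q k v with hx
      obtain ⟨c, hc, hcu⟩ := RCLike.exists_norm_eq_mul_self (u x)
      have hx0 : ∀ i, i < m ∨ k ≤ i → x i = 0 := by
        intro i hi
        rw [hx, lp.truncCLM_apply]
        split_ifs with h
        · rw [hv, lp.coeFn_sub, Pi.sub_apply, lp.truncCLM_apply, if_pos, sub_self]
          rcases hi with hi | hi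
          · exact hi
          · omega
        · rfl
      refine ⟨z + c • x, k, fun i hi => ?_, ?_, ?_⟩
      · rw [lp.coeFn_add, Pi.add_apply, lp.coeFn_smul, Pi.smul_apply, hz0 i (hmk.trans hi),
          hx0 i (Or.inr hi), smul_zero, add_zero]
      · rw [lp.norm_add_rpow_of_disjoint hq0]
        · push_cast
          refine add_le_add hz1 ?_
          rw [norm_smul, hc, one_mul]
          refine Real.rpow_le_one (norm_nonneg _) ?_ hq0.le
          exact (lp.norm_truncCLM_le hq0 _ _).trans ((lp.norm_sub_truncCLM_le hq0 _ _).trans hy1)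
        · intro i
          rcases lt_or_ge i m with h | h
          · right
            rw [lp.coeFn_smul, Pi.smul_apply, hx0 i (Or.inl h), smul_zero]
          · left; exact hz0 i h
      · rw [map_add, map_add, map_smul, smul_eq_mul, ← hcu, RCLike.ofReal_re]
        push_cast
        linarith
  refine not_forall_natCast_mul_le (C := ‖u‖) (α := 1 / q.toReal) hη ?_ fun N => ?_
  · rw [div_lt_one hq0]; exact hq1
  · obtain ⟨z, -, -, hz1, hz2⟩ := key N
    refine hz2.trans ((RCLike.re_le_norm _).trans ((u.le_opNorm z).trans ?_))
    refine mul_le_mul_of_nonneg_left ?_ (norm_nonneg _)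
    have := Real.rpow_le_rpow (Real.rpow_nonneg (norm_nonneg _) _) hz1 (one_div_nonneg.2 hq0.le)
    rwa [← Real.rpow_mul (norm_nonneg _), mul_one_div_cancel hq0.ne', Real.rpow_one] at this

theorem Real.mul_add_mul_le_rpow {r s a b x y : ℝ} (h : r.HolderConjugate s) (ha : 0 ≤ a)
    (hb : 0 ≤ b) (hx : 0 ≤ x) (hy : 0 ≤ y) :
    a * x + b * y ≤ (a ^ r + b ^ r) ^ (1 / r) * (x ^ s + y ^ s) ^ (1 / s) := by
  have := Real.inner_le_Lp_mul_Lq_of_nonneg (Finset.univ : Finset (Fin 2)) (f := ![a, b])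
    (g := ![x, y]) h (by intro i _; fin_cases i <;> simpa) (by intro i _; fin_cases i <;> simpa)
  simpa [Fin.sum_univ_two] using this

/-- Adding functionals that escape to infinity to a functional on `lp E q` increases the `r`-th
power of its norm by at most the `r`-th power of theirs, up to an error of `1`. -/
theorem lp.eventually_norm_add_sub_rpow_le (hq : q ≠ ∞) {r : ℝ} (hr : r.HolderConjugate q.toReal)
    (u : StrongDual 𝕜 (lp E q)) {d : ℕ → StrongDual 𝕜 (lp E q)} {B : ℝ} (hB : ∀ i, ‖d i‖ ≤ B)
    (hd : ∀ k, Tendsto (fun i => ‖(d i) ∘L (lp.truncCLM 𝕜 E q k)‖) atTop (𝓝 0)) :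
    ∀ᶠ i in atTop, ‖u + d i‖ ^ r ≤ ‖u‖ ^ r + B ^ r + 1 ∧ ‖u - d i‖ ^ r ≤ ‖u‖ ^ r + B ^ r + 1 := by
  have hr0 : 0 < r := hr.pos
  have hq0 : 0 < q.toReal := hr.symm.pos
  have hB0 : 0 ≤ B := (norm_nonneg _).trans (hB 0)
  set A := (‖u‖ ^ r + B ^ r) ^ (1 / r) with hA
  have hAB : 0 ≤ ‖u‖ ^ r + B ^ r := by positivity
  have hA0 : 0 ≤ A := Real.rpow_nonneg hAB _
  have hAr : A ^ r = ‖u‖ ^ r + B ^ r := by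
    rw [hA, ← Real.rpow_mul hAB, one_div_mul_cancel hr0.ne', Real.rpow_one]
  -- Two errors of size `η` occur: `u` on the tail and `d i` on the head. Hölder on the remaining
  -- main terms yields `A`.
  have hcont : Tendsto (fun t : ℝ => (A + 2 * t) ^ r) (𝓝[>] 0) (𝓝 (A ^ r)) := by
    have : Continuous fun t : ℝ => (A + 2 * t) ^ r :=
      (by fun_prop : Continuous fun t : ℝ => A + 2 * t).rpow_const fun _ => Or.inr hr0.le
    have h := this.tendsto 0
    rw [mul_zero, add_zero] at h
    exact h.mono_left nhdsWithin_le_nhds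
  obtain ⟨η, hη1, hη0⟩ := ((hcont.eventually (gt_mem_nhds (lt_add_one (A ^ r)))).and
    self_mem_nhdsWithin).exists
  have hη0 : 0 < η := hη0
  obtain ⟨k, hk⟩ := lp.exists_norm_apply_sub_truncCLM_le hq hr.symm.lt u hη0
  filter_upwards [(hd k).eventually (gt_mem_nhds hη0)] with i hi
  have hle : ∀ v : StrongDual 𝕜 (lp E q), (∀ x y, ‖v (x + y)‖ ≤
      ‖u x‖ + ‖u y‖ + (‖d i x‖ + ‖d i y‖)) → ‖v‖ ^ r ≤ ‖u‖ ^ r + B ^ r + 1 := by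
    intro v hv
    rw [← hAr]
    refine le_trans (Real.rpow_le_rpow (norm_nonneg _) ?_ hr0.le) hη1.le
    refine ContinuousLinearMap.opNorm_le_bound _ (by positivity) fun z => ?_
    set x := lp.truncCLM 𝕜 E q k z with hx
    have h1 : ‖u x‖ ≤ ‖u‖ * ‖x‖ := u.le_opNorm x
    have h2 : ‖u (z - x)‖ ≤ η * ‖z‖ := hk z
    have h3 : ‖d i x‖ ≤ η * ‖z‖ :=
      ((d i ∘L lp.truncCLM 𝕜 E q k).le_opNorm z).trans
        (mul_le_mul_of_nonneg_right hi.le (norm_nonneg _))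
    have h4 : ‖d i (z - x)‖ ≤ B * ‖z - x‖ :=
      ((d i).le_opNorm _).trans (mul_le_mul_of_nonneg_right (hB i) (norm_nonneg _))
    have h5 := Real.mul_add_mul_le_rpow hr (norm_nonneg u) hB0 (norm_nonneg x) (norm_nonneg (z - x))
    rw [hx, lp.norm_truncCLM_add hq0, ← Real.rpow_mul (norm_nonneg _),
      mul_one_div_cancel hq0.ne', Real.rpow_one, ← hx, ← hA] at h5
    have h6 := hv x (z - x)
    rw [add_sub_cancel] at h6
    linarith
  refine ⟨hle _ fun x y => ?_, hle _ fun x y => ?_⟩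
  · rw [add_apply, map_add, map_add]
    exact (norm_add_le _ _).trans (add_le_add (norm_add_le _ _) (norm_add_le _ _))
  · rw [sub_apply, map_add, map_add]
    exact (norm_sub_le _ _).trans (add_le_add (norm_add_le _ _) (norm_add_le _ _))

/-- A form of Pitt's theorem: an additive map into a Hilbert space that is bounded in the norm of
the dual of `lp E q`, `1 < q < 2`, is not bounded away from zero along a bounded sequence of
functionals escaping to infinity. -/
theorem lp.not_forall_le_norm_of_escaping (hq : q ≠ ∞) {r : ℝ} (hr : r.HolderConjugate q.toReal)
    (hr2 : 2 < r) {D : Type*} [AddCommGroup D] (Λ : D →+ StrongDual 𝕜 (lp E q)) {H : Type*}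
    [NormedAddCommGroup H] [InnerProductSpace 𝕜 H] (R : D →+ H) {C : ℝ}
    (hR : ∀ u, ‖R u‖ ≤ C * ‖Λ u‖) {d : ℕ → D} {B : ℝ} (hB : ∀ i, ‖Λ (d i)‖ ≤ B)
    (hd : ∀ k, Tendsto (fun i => ‖(Λ (d i)) ∘L (lp.truncCLM 𝕜 E q k)‖) atTop (𝓝 0)) {δ : ℝ}
    (hδ : 0 < δ) : ¬ ∀ i, δ ≤ ‖R (d i)‖ := by
  intro hle
  have hr0 : 0 < r := hr.pos
  have hB0 : 0 ≤ B := (norm_nonneg _).trans (hB 0)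
  have hBr : 0 ≤ B ^ r := Real.rpow_nonneg hB0 _
  -- By the parallelogram law one of the signs `u ± d i` raises the squared Hilbert norm by at least
  -- `δ ^ 2`, while the `r`-th power of the dual norm grows by at most `B ^ r + 1` for either sign.
  -- Since `r > 2`, growth like `N` against `N^{2/r}` is contradictory.
  have key : ∀ N : ℕ, ∃ u : D, ‖Λ u‖ ^ r ≤ N * (B ^ r + 1) ∧ N * δ ^ 2 ≤ ‖R u‖ ^ 2 := by
    intro N
    induction N with
    | zero => exact ⟨0, by simp [Real.zero_rpow hr0.ne'], by simp⟩
    | succ N ih =>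
      obtain ⟨u, hu1, hu2⟩ := ih
      have h1 := lp.eventually_norm_add_sub_rpow_le hq hr (Λ u) hB hd
      obtain ⟨i, h1, h2⟩ := h1.exists
      have hpar := parallelogram_law_with_norm 𝕜 (R u) (R (d i))
      have hδi : δ ^ 2 ≤ ‖R (d i)‖ ^ 2 := pow_le_pow_left₀ hδ.le (hle i) 2
      push_cast
      rcases le_total (‖R u - R (d i)‖ ^ 2) (‖R u + R (d i)‖ ^ 2) with h | h
      · refine ⟨u + d i, ?_, ?_⟩
        · rw [map_add]; linarith
        · rw [map_add]; linarith
      · refine ⟨u - d i, ?_, ?_⟩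
        · rw [map_sub]; linarith
        · rw [map_sub]; linarith
  refine not_forall_natCast_mul_le (η := δ ^ 2) (C := C ^ 2 * (B ^ r + 1) ^ (2 / r)) (α := 2 / r)
    (by positivity) ((div_lt_one hr0).2 hr2) fun N => ?_
  obtain ⟨u, hu1, hu2⟩ := key N
  have h1 : ‖Λ u‖ ^ 2 ≤ (N * (B ^ r + 1)) ^ (2 / r) := by
    have := Real.rpow_le_rpow (Real.rpow_nonneg (norm_nonneg _) _) hu1 (div_pos two_pos hr0).le
    rwa [← Real.rpow_mul (norm_nonneg _), mul_div_cancel₀ _ hr0.ne', Real.rpow_ofNat] at this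
  rw [Real.mul_rpow (Nat.cast_nonneg _) (by positivity)] at h1
  calc N * δ ^ 2 ≤ ‖R u‖ ^ 2 := hu2
    _ ≤ (C * ‖Λ u‖) ^ 2 := pow_le_pow_left₀ (norm_nonneg _) (hR u) 2
    _ = C ^ 2 * ‖Λ u‖ ^ 2 := by ring
    _ ≤ C ^ 2 * ((N : ℝ) ^ (2 / r) * (B ^ r + 1) ^ (2 / r)) :=
        mul_le_mul_of_nonneg_left h1 (sq_nonneg _)
    _ = _ := by ring

end Truncation

/-! ### Operators from a Hilbert space into an `ℓ_q`-sum. -/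

section Compactness

variable {𝕜 : Type*} [RCLike 𝕜] {E : ℕ → Type*} [∀ i, NormedAddCommGroup (E i)]
  [∀ i, NormedSpace 𝕜 (E i)] {q : ℝ≥0∞} [Fact (1 ≤ q)]

/-- The adjoint of an operator from a Hilbert space, as an additive map into that space. -/
def dualToHilbert {H : Type*} [NormedAddCommGroup H] [InnerProductSpace 𝕜 H] [CompleteSpace H]
    {Y : Type*} [NormedAddCommGroup Y] [NormedSpace 𝕜 Y] (T : H →L[𝕜] Y) :
    StrongDual 𝕜 Y →+ H where
  toFun u := (InnerProductSpace.toDual 𝕜 H).symm (u ∘L T)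
  map_zero' := by rw [ContinuousLinearMap.zero_comp, map_zero]
  map_add' u v := by rw [ContinuousLinearMap.add_comp, map_add]

theorem norm_dualToHilbert {H : Type*} [NormedAddCommGroup H] [InnerProductSpace 𝕜 H]
    [CompleteSpace H] {Y : Type*} [NormedAddCommGroup Y] [NormedSpace 𝕜 Y] (T : H →L[𝕜] Y)
    (u : StrongDual 𝕜 Y) : ‖dualToHilbert T u‖ = ‖u ∘L T‖ :=
  LinearIsometryEquiv.norm_map _ _

theorem ContinuousLinearMap.le_opNorm_of_mul_norm_lt {X Y : Type*} [NormedAddCommGroup X]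
    [NormedSpace 𝕜 X] [NormedAddCommGroup Y] [NormedSpace 𝕜 Y] (T : X →L[𝕜] Y) {η : ℝ} {x : X}
    (h : η * ‖x‖ < ‖T x‖) : η ≤ ‖T‖ := by
  by_contra! hlt
  have := T.le_opNorm x
  have h2 := mul_le_mul_of_nonneg_right hlt.le (norm_nonneg x)
  linarith

/-- The range of an operator from a Hilbert space to `lp E q`, `1 < q < 2`, is uniformly
concentrated on finitely many coordinates. -/
theorem lp.exists_norm_sub_truncCLM_le (hq : q ≠ ∞) {r : ℝ} (hr : r.HolderConjugate q.toReal)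
    (hr2 : 2 < r) {H : Type*} [NormedAddCommGroup H] [InnerProductSpace 𝕜 H] [CompleteSpace H]
    (S : H →L[𝕜] lp E q) {η : ℝ} (hη : 0 < η) :
    ∃ k, ∀ x, ‖S x - lp.truncCLM 𝕜 E q k (S x)‖ ≤ η * ‖x‖ := by
  by_contra! hcon
  have hq0 : 0 < q.toReal := hr.symm.pos
  choose x hx using hcon
  choose e he1 he2 using fun k => exists_dual_vector'' 𝕜 (S (x k) - lp.truncCLM 𝕜 E q k (S (x k)))
  -- Functionals norming the large tails, composed with the tail projections: they vanish on any
  -- fixed head once `k` is large.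
  let d : ℕ → StrongDual 𝕜 (lp E q) := fun k =>
    e k ∘L (ContinuousLinearMap.id 𝕜 _ - lp.truncCLM 𝕜 E q k)
  refine lp.not_forall_le_norm_of_escaping (D := StrongDual 𝕜 (lp E q)) hq hr hr2
    (AddMonoidHom.id _) (dualToHilbert S) (C := ‖S‖) (d := d) (B := 1) (fun u => ?_) (fun k => ?_)
    (fun j => ?_) hη fun k => ?_
  · rw [norm_dualToHilbert, mul_comm]
    exact u.opNorm_comp_le S
  · refine ContinuousLinearMap.opNorm_le_bound _ zero_le_one fun z => ?_
    refine ((e k).le_opNorm _).trans ?_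
    exact mul_le_mul (he1 k) (lp.norm_sub_truncCLM_le hq0 k z) (norm_nonneg _) zero_le_one
  · refine tendsto_const_nhds.congr' ?_
    filter_upwards [eventually_ge_atTop j] with k hk
    have : d k ∘L lp.truncCLM 𝕜 E q j = 0 := by
      ext z
      change e k (lp.truncCLM 𝕜 E q j z - lp.truncCLM 𝕜 E q k (lp.truncCLM 𝕜 E q j z)) = 0
      have h0 : lp.truncCLM 𝕜 E q k (lp.truncCLM 𝕜 E q j z) = lp.truncCLM 𝕜 E q j z := by
        apply lp.ext
        funext i
        simp only [lp.truncCLM_apply]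
        split_ifs <;> first | rfl | omega
      rw [h0, sub_self, map_zero]
    change 0 = ‖d k ∘L lp.truncCLM 𝕜 E q j‖
    rw [this]
    exact ContinuousLinearMap.opNorm_zero.symm
  · rw [norm_dualToHilbert]
    refine (d k ∘L S).le_opNorm_of_mul_norm_lt (x := x k) ?_
    change _ < ‖e k (S (x k) - lp.truncCLM 𝕜 E q k (S (x k)))‖
    rw [he2 k, RCLike.norm_ofReal, abs_of_nonneg (norm_nonneg _)]
    exact hx k

end Compactness

/-! ### Operators from `ℓ_2` into quotients of `ℓ_q`. -/

section Quotient

variable {𝕜 : Type} [RCLike 𝕜] {q : ℝ≥0∞} [Fact (1 ≤ q)]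

theorem norm_comp_truncCLM_le (u : StrongDual 𝕜 (SeqLp 𝕜 q)) (k : ℕ) :
    ‖u ∘L lp.truncCLM 𝕜 (fun _ : ℕ => 𝕜) q k‖ ≤
      ∑ j ∈ Finset.range k, ‖u (lp.single q j (1 : 𝕜))‖ := by
  refine ContinuousLinearMap.opNorm_le_bound _ (Finset.sum_nonneg fun _ _ => norm_nonneg _)
    fun z => ?_
  change ‖u (lp.truncCLM 𝕜 (fun _ : ℕ => 𝕜) q k z)‖ ≤ _
  rw [lp.truncCLM_eq_sum, map_sum, Finset.sum_mul]
  refine norm_sum_le_of_le _ fun j _ => ?_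
  have h : lp.single q j (z j) = z j • lp.single (E := fun _ : ℕ => 𝕜) q j (1 : 𝕜) := by
    rw [← lp.single_smul, smul_eq_mul, mul_one]
  rw [h, map_smul, norm_smul, mul_comm]
  exact mul_le_mul_of_nonneg_left
    (lp.norm_apply_le_norm (zero_lt_one.trans_le Fact.out).ne' z j) (norm_nonneg _)

/-- An operator from `ℓ_2` to a quotient of `ℓ_q`, `1 < q < 2`, is small on vectors supported far
out. -/
theorem exists_norm_le_of_surjective (hq : q ≠ ∞) {r : ℝ} (hr : r.HolderConjugate q.toReal)
    (hr2 : 2 < r) {Y : Type*} [NormedAddCommGroup Y] [NormedSpace 𝕜 Y] [CompleteSpace Y]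
    (π : SeqLp 𝕜 q →L[𝕜] Y) (hπ : Function.Surjective π) (T : SeqLp 𝕜 2 →L[𝕜] Y) {η : ℝ}
    (hη : 0 < η) : ∃ N, ∀ x : SeqLp 𝕜 2, (∀ i < N, x i = 0) → ‖T x‖ ≤ η * ‖x‖ := by
  by_contra! hcon
  choose x hx0 hx using hcon
  choose y hy1 hy2 using fun n => exists_dual_vector'' 𝕜 (T (x n))
  -- A subsequence of the norming functionals, pulled back to `ℓ_q`, converges coordinatewise, so
  -- differences along it escape to infinity.
  set c : ℕ → ℕ → 𝕜 := fun n j => y n (π (lp.single q j 1)) with hc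
  have hq0 : 0 < q := zero_lt_one.trans_le Fact.out
  have hcomp : IsCompact (Set.univ.pi fun _ : ℕ => Metric.closedBall (0 : 𝕜) ‖π‖) :=
    isCompact_univ_pi fun _ => isCompact_closedBall _ _
  have hmem : ∀ n, c n ∈ Set.univ.pi fun _ : ℕ => Metric.closedBall (0 : 𝕜) ‖π‖ := by
    intro n j _
    rw [mem_closedBall_zero_iff]
    have h1 : ‖π (lp.single q j 1)‖ ≤ ‖π‖ := by
      have := π.le_opNorm (lp.single q j 1)
      rwa [lp.norm_single hq0, norm_one, mul_one] at this
    refine ((y n).le_opNorm _).trans ?_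
    calc ‖y n‖ * ‖π (lp.single q j 1)‖ ≤ 1 * ‖π‖ :=
          mul_le_mul (hy1 n) h1 (norm_nonneg _) zero_le_one
      _ = _ := one_mul _
  obtain ⟨c₀, -, φ, hφ, hlim⟩ := hcomp.tendsto_subseq hmem
  rw [tendsto_pi_nhds] at hlim
  have hk : ∀ i, ∃ k, ∀ z : SeqLp 𝕜 2,
      ‖(y (φ i) ∘L T) (z - lp.truncCLM 𝕜 (fun _ : ℕ => 𝕜) 2 k z)‖ ≤ η / 2 * ‖z‖ := fun i =>
    lp.exists_norm_apply_sub_truncCLM_le (by norm_num) (by norm_num) _ (half_pos hη)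
  choose k hk using hk
  -- The vector `x (φ (ν i))` vanishes on the first `k i` coordinates, so `y (φ i) ∘L T` takes at
  -- most half of the value `η ‖x‖` there and cannot cancel `y (φ (ν i))`.
  set ν : ℕ → ℕ := fun i => max (k i) i with hν
  have hν_lim : Tendsto ν atTop atTop :=
    tendsto_atTop_mono (fun i => le_max_right _ _) tendsto_id
  set d : ℕ → StrongDual 𝕜 Y := fun i => y (φ (ν i)) - y (φ i) with hd
  let Λ : StrongDual 𝕜 Y →+ StrongDual 𝕜 (SeqLp 𝕜 q) :=
    { toFun := fun u => u ∘L π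
      map_zero' := ContinuousLinearMap.zero_comp _
      map_add' := fun u v => ContinuousLinearMap.add_comp _ _ _ }
  -- Bounded lifting through `π` controls the adjoint of `T` by the norm of the pulled-back
  -- functional, as the Pitt argument requires.
  obtain ⟨C₀, hC₀, hlift⟩ := π.exists_preimage_norm_le hπ
  refine lp.not_forall_le_norm_of_escaping hq hr hr2 Λ (dualToHilbert T) (C := C₀ * ‖T‖) (d := d)
    (B := 2 * ‖π‖) (fun u => ?_) (fun i => ?_) (fun m => ?_) (half_pos hη) fun i => ?_
  · rw [norm_dualToHilbert]
    refine ContinuousLinearMap.opNorm_le_bound _ (by positivity) fun z => ?_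
    obtain ⟨s, hs, hs'⟩ := hlift (T z)
    change ‖u (T z)‖ ≤ _
    rw [← hs]
    calc ‖u (π s)‖ ≤ ‖u ∘L π‖ * ‖s‖ := (u ∘L π).le_opNorm s
      _ ≤ ‖u ∘L π‖ * (C₀ * (‖T‖ * ‖z‖)) := by
          refine mul_le_mul_of_nonneg_left ?_ (norm_nonneg _)
          exact hs'.trans (mul_le_mul_of_nonneg_left (T.le_opNorm z) hC₀.le)
      _ = C₀ * ‖T‖ * ‖u ∘L π‖ * ‖z‖ := by ring
  · change ‖d i ∘L π‖ ≤ _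
    refine (ContinuousLinearMap.opNorm_comp_le _ _).trans ?_
    refine mul_le_mul_of_nonneg_right ?_ (norm_nonneg _)
    refine (norm_sub_le _ _).trans ?_
    linarith [hy1 (φ (ν i)), hy1 (φ i)]
  · have hlim0 : Tendsto (fun i => ∑ j ∈ Finset.range m, ‖Λ (d i) (lp.single q j (1 : 𝕜))‖) atTop
        (𝓝 0) := by
      rw [← Finset.sum_const_zero (s := Finset.range m)]
      refine tendsto_finsetSum _ fun j _ => ?_
      have := (((hlim j).comp hν_lim).sub (hlim j)).norm
      rw [sub_self, norm_zero] at this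
      exact this
    exact squeeze_zero (fun _ => norm_nonneg _) (fun i => norm_comp_truncCLM_le _ _) hlim0
  · rw [norm_dualToHilbert]
    set z := x (φ (ν i)) with hz
    have hz0 : lp.truncCLM 𝕜 (fun _ : ℕ => 𝕜) 2 (k i) z = 0 := by
      apply lp.ext
      funext j
      rw [lp.truncCLM_apply]
      split_ifs with h
      · exact hx0 _ j (h.trans_le ((le_max_left _ _).trans (hφ.id_le _)))
      · rfl
    have h1 := hk i z
    rw [hz0, sub_zero] at h1
    have h2 : η * ‖z‖ < ‖y (φ (ν i)) (T z)‖ := by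
      rw [hz, hy2, RCLike.norm_ofReal, abs_of_nonneg (norm_nonneg _)]
      exact hx _
    refine (d i ∘L T).le_opNorm_of_mul_norm_lt (x := z) ?_
    have h3 : (d i ∘L T) z = y (φ (ν i)) (T z) - (y (φ i) ∘L T) z := rfl
    rw [h3]
    have := norm_sub_norm_le (y (φ (ν i)) (T z)) ((y (φ i) ∘L T) z)
    linarith

end Quotient

/-! ### Almost orthogonal subsequences in Hilbert space. -/

section AlmostOrthogonal

variable {𝕜 : Type} [RCLike 𝕜] {H : Type*} [NormedAddCommGroup H] [InnerProductSpace 𝕜 H]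

/-- The Gram matrix differs from `l ^ 2` times the identity by geometrically small entries, so
Cauchy–Schwarz bounds the difference of the squared norms by `(η t) ^ 2`; then `(x - lt) ^ 2 ≤ |x ^
2 - (lt) ^ 2|` for nonnegative `x` and `lt`. -/
theorem abs_norm_sum_smul_sub_le {v : ℕ → H} {l η : ℝ} (hl : 0 ≤ l) (hη : 0 ≤ η)
    (h : ∀ n m, ‖inner 𝕜 (v n) (v m) - if n = m then ((l ^ 2 : ℝ) : 𝕜) else 0‖ ≤
      η ^ 2 / 2 * ((1 / 2) ^ n * (1 / 2) ^ m)) (a : ℕ → 𝕜) (N : ℕ) :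
    |‖∑ n ∈ Finset.range N, a n • v n‖ - l * l2Trunc a N| ≤ η * l2Trunc a N := by
  set x := ‖∑ n ∈ Finset.range N, a n • v n‖ with hx
  set t := l2Trunc a N with ht
  have ht0 : 0 ≤ t := l2Trunc_nonneg _ _
  have hexp : ((x ^ 2 - (l * t) ^ 2 : ℝ) : 𝕜) = ∑ n ∈ Finset.range N, ∑ m ∈ Finset.range N,
      (starRingEnd 𝕜 (a n) * a m) *
        (inner 𝕜 (v n) (v m) - if n = m then ((l ^ 2 : ℝ) : 𝕜) else 0) := by
    simp only [mul_sub, Finset.sum_sub_distrib, mul_ite, mul_zero, Finset.sum_ite_eq]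
    rw [RCLike.ofReal_sub]
    congr 1
    · rw [hx, RCLike.ofReal_pow, ← inner_self_eq_norm_sq_to_K (𝕜 := 𝕜), sum_inner]
      refine Finset.sum_congr rfl fun n _ => ?_
      rw [inner_sum]
      refine Finset.sum_congr rfl fun m _ => ?_
      rw [inner_smul_left, inner_smul_right, mul_assoc]
    · rw [mul_pow, ht, l2Trunc_sq, Finset.mul_sum, RCLike.ofReal_sum]
      refine Finset.sum_congr rfl fun n hn => ?_
      rw [if_pos hn, RCLike.conj_mul]
      push_cast
      ring
  have hgeom : ∑ n ∈ Finset.range N, ((1 / 2 : ℝ) ^ n) ^ 2 ≤ 2 := by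
    calc ∑ n ∈ Finset.range N, ((1 / 2 : ℝ) ^ n) ^ 2 ≤ ∑ n ∈ Finset.range N, (1 / 2 : ℝ) ^ n := by
          refine Finset.sum_le_sum fun n _ => ?_
          have h0 : (0 : ℝ) ≤ (1 / 2) ^ n := by positivity
          have h1 : (1 / 2 : ℝ) ^ n ≤ 1 := pow_le_one₀ (by norm_num) (by norm_num)
          nlinarith
      _ ≤ 2 := sum_geometric_two_le N
  have hsq : |x ^ 2 - (l * t) ^ 2| ≤ (η * t) ^ 2 := by
    rw [← RCLike.norm_ofReal (K := 𝕜), hexp]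
    calc _ ≤ ∑ n ∈ Finset.range N, ∑ m ∈ Finset.range N,
            η ^ 2 / 2 * ((‖a n‖ * (1 / 2) ^ n) * (‖a m‖ * (1 / 2) ^ m)) := by
          refine norm_sum_le_of_le _ fun n _ => norm_sum_le_of_le _ fun m _ => ?_
          rw [norm_mul, norm_mul, RCLike.norm_conj]
          calc _ ≤ ‖a n‖ * ‖a m‖ * (η ^ 2 / 2 * ((1 / 2) ^ n * (1 / 2) ^ m)) :=
                mul_le_mul_of_nonneg_left (h n m) (by positivity)
            _ = _ := by ring
      _ = η ^ 2 / 2 * (∑ n ∈ Finset.range N, ‖a n‖ * (1 / 2) ^ n) ^ 2 := by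
          simp only [← Finset.mul_sum, pow_two, Finset.sum_mul]
      _ ≤ η ^ 2 / 2 * (t ^ 2 * 2) := by
          refine mul_le_mul_of_nonneg_left ?_ (by positivity)
          refine (Finset.sum_mul_sq_le_sq_mul_sq _ _ _).trans ?_
          rw [ht, l2Trunc_sq]
          exact mul_le_mul_of_nonneg_left hgeom (Finset.sum_nonneg fun _ _ => by positivity)
      _ = (η * t) ^ 2 := by ring
  have hx0 : 0 ≤ x := norm_nonneg _
  have hlt : 0 ≤ l * t := mul_nonneg hl ht0
  refine abs_le_of_sq_le_sq (le_trans ?_ hsq) (mul_nonneg hη ht0)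
  have hab : |x - l * t| ≤ |x + l * t| := by
    rw [abs_of_nonneg (add_nonneg hx0 hlt), abs_le]
    constructor <;> linarith
  calc (x - l * t) ^ 2 = |x - l * t| * |x - l * t| := by rw [abs_mul_abs_self, pow_two]
    _ ≤ |x - l * t| * |x + l * t| := mul_le_mul_of_nonneg_left hab (abs_nonneg _)
    _ = |x ^ 2 - (l * t) ^ 2| := by rw [← abs_mul]; congr 1; ring

theorem inner_stdBasisL2_left (n : ℕ) (x : SeqLp 𝕜 2) : inner 𝕜 (stdBasisL2 𝕜 n) x = x n := by
  rw [stdBasisL2, lp.inner_single_left]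
  simp

theorem tendsto_inner_apply_stdBasisL2 [CompleteSpace H] (A : SeqLp 𝕜 2 →L[𝕜] H) (v : H) :
    Tendsto (fun n => inner 𝕜 (A (stdBasisL2 𝕜 n)) v) atTop (𝓝 0) := by
  have h : ∀ n, inner 𝕜 (A (stdBasisL2 𝕜 n)) v = A.adjoint v n := fun n => by
    rw [← ContinuousLinearMap.adjoint_inner_right, inner_stdBasisL2_left]
  simp only [h]
  rw [tendsto_zero_iff_norm_tendsto_zero]
  have h1 := ((lp.memℓp (A.adjoint v)).summable (by norm_num)).tendsto_atTop_zero
  have h2 := h1.rpow_const (p := 1 / 2) (Or.inr (by norm_num))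
  rw [Real.zero_rpow (by norm_num)] at h2
  refine h2.congr fun n => ?_
  rw [← Real.rpow_mul (norm_nonneg _)]
  norm_num

/-- Finitely many operators from `ℓ_2` are simultaneously almost multiples of isometries along a
subsequence of the standard basis. -/
theorem exists_subseq_almost_isometric [CompleteSpace H] (A : ℕ → SeqLp 𝕜 2 →L[𝕜] H) (k N₀ : ℕ)
    {η : ℝ} (hη : 0 < η) :
    ∃ (l : ℕ → ℝ) (φ : ℕ → ℕ), StrictMono φ ∧ (∀ n, N₀ ≤ φ n) ∧ ∀ j < k, ∀ (a : ℕ → 𝕜) (N : ℕ),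
      |‖∑ n ∈ Finset.range N, a n • A j (stdBasisL2 𝕜 (φ n))‖ - l j * l2Trunc a N| ≤
        η * l2Trunc a N := by
  classical
  set e := stdBasisL2 𝕜 with he
  have hnorm : ∀ n, ‖e n‖ = 1 := fun n => by
    rw [he, stdBasisL2, lp.norm_single (by norm_num), norm_one]
  have hbdd : ∀ n, (fun j : Fin k => ‖A j (e n)‖) ∈
      Set.univ.pi fun j : Fin k => Metric.closedBall (0 : ℝ) ‖A j‖ := by
    intro n j _
    rw [mem_closedBall_zero_iff, norm_norm]
    have := (A j).le_opNorm (e n)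
    rwa [hnorm, mul_one] at this
  obtain ⟨l₀, -, ψ, hψ, hlim⟩ := (isCompact_univ_pi fun j : Fin k =>
    isCompact_closedBall (0 : ℝ) ‖A j‖).tendsto_subseq hbdd
  rw [tendsto_pi_nhds] at hlim
  set l : ℕ → ℝ := fun j => if h : j < k then l₀ ⟨j, h⟩ else 0 with hl
  have hlim' : ∀ j < k, Tendsto (fun n => ‖A j (e (ψ n))‖) atTop (𝓝 (l j)) := by
    intro j hj
    have := hlim ⟨j, hj⟩
    simpa [hl, hj] using this
  have hl0 : ∀ j, 0 ≤ l j := by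
    intro j
    by_cases hj : j < k
    · exact ge_of_tendsto' (hlim' j hj) fun n => norm_nonneg _
    · simp [hl, hj]
  set δ := η ^ 2 / 2 with hδ
  have hδ0 : 0 < δ := by positivity
  -- The second entry of each pair is a strictly increasing rank, hence at least the position in the
  -- sequence; it fixes the geometric tolerance before that position is known. Inner products with
  -- earlier images tend to `0` because the images of the basis are weakly null.
  obtain ⟨g, hg1, hg2⟩ := exists_seq_of_forall_finset_exists
    (fun x : ℕ × ℕ => N₀ ≤ ψ x.1 ∧ ∀ j < k,
      |‖A j (e (ψ x.1))‖ ^ 2 - l j ^ 2| < δ * ((1 / 2) ^ x.2 * (1 / 2) ^ x.2))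
    (fun x y : ℕ × ℕ => x.1 < y.1 ∧ x.2 < y.2 ∧ ∀ j < k,
      ‖inner 𝕜 (A j (e (ψ y.1))) (A j (e (ψ x.1)))‖ < δ * ((1 / 2) ^ x.2 * (1 / 2) ^ y.2)) (by
    intro s _
    set i := s.sup (fun x => x.2) + 1 with hi
    have h1 : ∀ᶠ m in atTop, N₀ ≤ ψ m := hψ.tendsto_atTop.eventually_ge_atTop N₀
    have h2 : ∀ᶠ m in atTop, ∀ j < k,
        |‖A j (e (ψ m))‖ ^ 2 - l j ^ 2| < δ * ((1 / 2) ^ i * (1 / 2) ^ i) := by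
      have : ∀ᶠ m in atTop, ∀ j ∈ Finset.range k,
          |‖A j (e (ψ m))‖ ^ 2 - l j ^ 2| < δ * ((1 / 2) ^ i * (1 / 2) ^ i) := by
        rw [Filter.eventually_all_finset]
        intro j hj
        have := (((hlim' j (Finset.mem_range.1 hj)).pow 2).sub_const (l j ^ 2)).abs
        rw [sub_self, abs_zero] at this
        exact this.eventually (gt_mem_nhds (by positivity))
      simpa only [Finset.mem_range] using this
    have h3 : ∀ᶠ m in atTop, ∀ x ∈ s, x.1 < m ∧ ∀ j < k,
        ‖inner 𝕜 (A j (e (ψ m))) (A j (e (ψ x.1)))‖ < δ * ((1 / 2) ^ x.2 * (1 / 2) ^ i) := by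
      rw [Filter.eventually_all_finset]
      intro x _
      refine (eventually_gt_atTop x.1).and ?_
      have : ∀ᶠ m in atTop, ∀ j ∈ Finset.range k,
          ‖inner 𝕜 (A j (e (ψ m))) (A j (e (ψ x.1)))‖ < δ * ((1 / 2) ^ x.2 * (1 / 2) ^ i) := by
        rw [Filter.eventually_all_finset]
        intro j _
        have := ((tendsto_inner_apply_stdBasisL2 (A j) (A j (e (ψ x.1)))).comp
          hψ.tendsto_atTop).norm
        rw [norm_zero] at this
        exact this.eventually (gt_mem_nhds (by positivity))
      simpa only [Finset.mem_range] using this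
    obtain ⟨m, h1, h2, h3⟩ := (h1.and (h2.and h3)).exists
    exact ⟨(m, i), ⟨h1, h2⟩, fun x hx => ⟨(h3 x hx).1,
      Nat.lt_succ_of_le (Finset.le_sup (f := fun x : ℕ × ℕ => x.2) hx), (h3 x hx).2⟩⟩)
  have hrank : StrictMono fun n => (g n).2 := fun m n hmn => (hg2 m n hmn).2.1
  have hpow : ∀ n, (1 / 2 : ℝ) ^ (g n).2 ≤ (1 / 2) ^ n := fun n =>
    pow_le_pow_of_le_one (by norm_num) (by norm_num) (hrank.id_le n)
  have hpow2 : ∀ n m, δ * ((1 / 2 : ℝ) ^ (g n).2 * (1 / 2) ^ (g m).2) ≤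
      δ * ((1 / 2) ^ n * (1 / 2) ^ m) := fun n m =>
    mul_le_mul_of_nonneg_left (mul_le_mul (hpow n) (hpow m) (by positivity) (by positivity)) hδ0.le
  refine ⟨l, fun n => ψ (g n).1, fun m n hmn => hψ (hg2 m n hmn).1, fun n => (hg1 n).1,
    fun j hj => abs_norm_sum_smul_sub_le (hl0 j) hη.le fun n m => ?_⟩
  rcases lt_trichotomy n m with h | h | h
  · rw [if_neg h.ne, sub_zero, norm_inner_symm]
    exact ((hg2 n m h).2.2 j hj).le.trans (hpow2 n m)
  · subst h
    rw [if_pos rfl, inner_self_eq_norm_sq_to_K, ← RCLike.ofReal_pow, ← RCLike.ofReal_sub,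
      RCLike.norm_ofReal]
    exact ((hg1 n).2 j hj).le.trans (hpow2 n n)
  · rw [if_neg h.ne', sub_zero]
    refine ((hg2 m n h).2.2 j hj).le.trans ((hpow2 m n).trans (le_of_eq (by ring)))

theorem norm_sum_smul_stdBasisL2_comp {φ : ℕ → ℕ} (hφ : Function.Injective φ) (a : ℕ → 𝕜) (N : ℕ) :
    ‖∑ n ∈ Finset.range N, a n • stdBasisL2 𝕜 (φ n)‖ = l2Trunc a N := by
  have h := abs_norm_sum_smul_sub_le (v := fun n => stdBasisL2 𝕜 (φ n)) (l := 1) (η := 0)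
    zero_le_one le_rfl (fun n m => by
      rw [inner_stdBasisL2_left, stdBasisL2_apply]
      simp [hφ.eq_iff]) a N
  rw [zero_mul, one_mul, abs_nonpos_iff, sub_eq_zero] at h
  exact h

end AlmostOrthogonal

/-! ### Property `P₂` for the `ℓ_q`-sum plus a quotient of `ℓ_q`. -/

section SumQuotient

variable {𝕜 : Type} [RCLike 𝕜] {q : ℝ≥0∞} [Fact (1 ≤ q)]

/-- This is why the exponent `r` of the direct sum is immaterial: the second component will be
negligible. -/
theorem WithLp.abs_norm_sub_norm_le {X Y : Type*} [NormedAddCommGroup X] [NormedAddCommGroup Y]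
    (r : ℝ≥0∞) [Fact (1 ≤ r)] (z : WithLp r (X × Y)) : |‖z‖ - ‖z.fst‖| ≤ ‖z.snd‖ := by
  have h : z - WithLp.toLp r (z.fst, 0) = WithLp.toLp r ((0 : X), z.snd) := by
    apply WithLp.ofLp_injective
    ext <;> simp
  rw [← WithLp.norm_toLp_fst r X Y z.fst, ← WithLp.norm_toLp_snd r X Y z.snd, ← h]
  exact _root_.abs_norm_sub_norm_le _ _

/-- A vector of `(ℓ_2 ⊕ ℓ_2 ⊕ ⋯)_{ℓ_q}` whose first `k` components have norms close to `l_j t` has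
truncation with norm close to `t` times the norm of `(l_j)_{j < k}`. -/
theorem abs_norm_truncCLM_sub_le (hq : 0 < q.toReal) (z : SumSeqL2 𝕜 q) (k : ℕ) (l : ℕ → ℝ)
    {t η : ℝ} (ht : 0 ≤ t) (h : ∀ j < k, |‖z j‖ - l j * t| ≤ η * t) :
    |‖lp.truncCLM 𝕜 (fun _ : ℕ => SeqLp 𝕜 2) q k z‖ -
      ‖∑ j ∈ Finset.range k, lp.single (E := fun _ : ℕ => 𝕜) q j ((l j : ℝ) : 𝕜)‖ * t| ≤
        k * η * t := by
  set u : SeqLp 𝕜 q := ∑ j ∈ Finset.range k, lp.single q j ((‖z j‖ : ℝ) : 𝕜) with hu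
  set y : SeqLp 𝕜 q := ∑ j ∈ Finset.range k, lp.single q j ((l j : ℝ) : 𝕜) with hy
  have h1 : ‖lp.truncCLM 𝕜 (fun _ : ℕ => SeqLp 𝕜 2) q k z‖ = ‖u‖ := by
    rw [← Real.rpow_left_inj (norm_nonneg _) (norm_nonneg _) hq.ne', lp.truncCLM_eq_sum,
      lp.norm_sum_single hq (fun j => z j), hu,
      lp.norm_sum_single hq (fun j => ((‖z j‖ : ℝ) : 𝕜))]
    simp
  have h2 : ‖y‖ * t = ‖((t : ℝ) : 𝕜) • y‖ := by
    rw [norm_smul, RCLike.norm_ofReal, abs_of_nonneg ht, mul_comm]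
  rw [h1, h2]
  refine (_root_.abs_norm_sub_norm_le _ _).trans ?_
  have h3 : u - ((t : ℝ) : 𝕜) • y =
      ∑ j ∈ Finset.range k, lp.single q j ((‖z j‖ - l j * t : ℝ) : 𝕜) := by
    rw [hu, hy, Finset.smul_sum, ← Finset.sum_sub_distrib]
    refine Finset.sum_congr rfl fun j _ => ?_
    rw [← lp.single_smul, ← lp.single_sub]
    congr 1
    rw [smul_eq_mul]
    push_cast
    ring
  rw [h3]
  calc _ ≤ ∑ j ∈ Finset.range k, η * t := by
        refine norm_sum_le_of_le _ fun j hj => ?_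
        rw [lp.norm_single (zero_lt_one.trans_le Fact.out), RCLike.norm_ofReal]
        exact h j (Finset.mem_range.1 hj)
    _ = k * η * t := by rw [Finset.sum_const, Finset.card_range, nsmul_eq_mul]; ring

/-- The sum of `(ℓ_2 ⊕ ℓ_2 ⊕ ⋯)_{ℓ_q}` and a quotient of `ℓ_q`, `1 < q < 2`, satisfies `P₂`. -/
theorem propertyP2_withLp (hq : q ≠ ∞) {s : ℝ} (hs : s.HolderConjugate q.toReal) (hs2 : 2 < s)
    {Y : Type*} [NormedAddCommGroup Y] [NormedSpace 𝕜 Y] [CompleteSpace Y]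
    (π : SeqLp 𝕜 q →L[𝕜] Y) (hπ : Function.Surjective π) (r : ℝ≥0∞) [Fact (1 ≤ r)] :
    PropertyP2 𝕜 (WithLp r (SumSeqL2 𝕜 q × Y)) := by
  intro ε hε f hf
  obtain ⟨S, c, hc, hSf, hSc⟩ := hf.exists_clm
  let SW : SeqLp 𝕜 2 →L[𝕜] SumSeqL2 𝕜 q := WithLp.fstL r 𝕜 (SumSeqL2 𝕜 q) Y ∘L S
  let SY : SeqLp 𝕜 2 →L[𝕜] Y := WithLp.sndL r 𝕜 (SumSeqL2 𝕜 q) Y ∘L S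
  have hSW : ∀ x, (S x).fst = SW x := fun _ => rfl
  have hSY : ∀ x, (S x).snd = SY x := fun _ => rfl
  -- There are three errors of size `η`: the second component, the tail of the first, and the
  -- finitely many coordinates together. With this choice `3η(1 + ε) = cε/2`, while `L ≥ c - 3η ≥
  -- c/2`.
  set η := c * ε / (6 * (1 + ε)) with hη
  have hη0 : 0 < η := by positivity
  obtain ⟨k, hk⟩ := lp.exists_norm_sub_truncCLM_le hq hs hs2 SW hη0
  obtain ⟨N₀, hN₀⟩ := exists_norm_le_of_surjective hq hs hs2 π hπ SY hη0
  set η' := η / (k + 1) with hη'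
  have hη'0 : 0 < η' := by positivity
  have hkη : k * η' ≤ η := by
    rw [hη', mul_div_assoc', div_le_iff₀ (by positivity)]
    nlinarith
  obtain ⟨l, φ, hφ, hφN, hl⟩ := exists_subseq_almost_isometric
    (fun j => lp.evalCLM 𝕜 (fun _ : ℕ => SeqLp 𝕜 2) q j ∘L SW) k N₀ hη'0
  -- The common scale is the `ℓ_q` norm of the limiting norms in the first `k` coordinates.
  set L := ‖∑ j ∈ Finset.range k, lp.single (E := fun _ : ℕ => 𝕜) q j ((l j : ℝ) : 𝕜)‖ with hL
  have key : ∀ (a : ℕ → 𝕜) (N : ℕ), |‖∑ n ∈ Finset.range N, a n • f (φ n)‖ - L * l2Trunc a N| ≤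
      3 * η * l2Trunc a N ∧ c * l2Trunc a N ≤ ‖∑ n ∈ Finset.range N, a n • f (φ n)‖ := by
    intro a N
    set x : SeqLp 𝕜 2 := ∑ n ∈ Finset.range N, a n • stdBasisL2 𝕜 (φ n) with hx
    set t := l2Trunc a N with ht
    have ht0 : 0 ≤ t := l2Trunc_nonneg _ _
    have hxt : ‖x‖ = t := norm_sum_smul_stdBasisL2_comp hφ.injective a N
    have hSx : ∑ n ∈ Finset.range N, a n • f (φ n) = S x := by
      rw [hx, map_sum]
      exact Finset.sum_congr rfl fun n _ => by rw [map_smul, hSf]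
    have hx0 : ∀ i < N₀, x i = 0 := by
      intro i hi
      rw [hx, lp.coeFn_sum, Finset.sum_apply]
      refine Finset.sum_eq_zero fun n _ => ?_
      rw [lp.coeFn_smul, Pi.smul_apply, stdBasisL2_apply, if_neg, smul_zero]
      exact (hi.trans_le (hφN n)).ne
    have h1 := WithLp.abs_norm_sub_norm_le r (S x)
    rw [hSW, hSY] at h1
    have h2 := hN₀ x hx0
    have h3 := hk x
    have h4 := (_root_.abs_norm_sub_norm_le _ _).trans h3
    have h5 := abs_norm_truncCLM_sub_le (q := q) hs.symm.pos (SW x) k l ht0 (η := η') fun j hj => by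
      have := hl j hj a N
      have h6 : ∑ n ∈ Finset.range N, a n •
          (lp.evalCLM 𝕜 (fun _ : ℕ => SeqLp 𝕜 2) q j ∘L SW) (stdBasisL2 𝕜 (φ n)) = SW x j := by
        have : SW x j = (lp.evalCLM 𝕜 (fun _ : ℕ => SeqLp 𝕜 2) q j ∘L SW) x := rfl
        rw [this, hx, map_sum]
        exact Finset.sum_congr rfl fun n _ => (map_smul _ _ _).symm
      rwa [h6] at this
    have h7 : k * η' * t ≤ η * t := mul_le_mul_of_nonneg_right hkη ht0
    rw [hxt] at h2 h3 h4
    rw [hSx]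
    refine ⟨?_, by rw [← hxt]; exact hSc x⟩
    rw [← hL] at h5
    rw [abs_le] at h1 h4 h5 ⊢
    constructor <;> linarith
  have hLc : c - 3 * η ≤ L := by
    obtain ⟨h1, h2⟩ := key (fun _ => 1) 1
    rw [l2Trunc_one, Nat.cast_one, Real.sqrt_one, abs_le] at h1
    rw [l2Trunc_one, Nat.cast_one, Real.sqrt_one] at h2
    linarith [h1.2]
  have h3η : 3 * η * (1 + ε) = c * ε / 2 := by
    rw [hη]; field_simp; ring
  have hηc : 3 * η ≤ c / 2 := by
    have : 3 * η * (1 + ε) ≤ c / 2 * (1 + ε) := by rw [h3η]; nlinarith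
    exact le_of_mul_le_mul_right this (by positivity)
  have hL0 : 0 < L := by linarith
  have h3L : 3 * η * (1 + ε) ≤ L * ε := by
    rw [h3η]; nlinarith
  refine ⟨φ, hφ, HasL2Bounds.kEquivalentSeq (L := L) (by positivity) hL0 fun a N => ?_⟩
  have h1 := abs_le.1 (key a N).1
  have ht0 : 0 ≤ l2Trunc a N := l2Trunc_nonneg _ _
  have h2 : 3 * η ≤ L * ε := by nlinarith
  simp only [Function.comp_apply]
  constructor
  · have h4 : L / (1 + ε) ≤ L - 3 * η := by
      rw [div_le_iff₀ (by positivity)]; linarith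
    have := mul_le_mul_of_nonneg_right h4 ht0
    linarith
  · have h4 : L + 3 * η ≤ (1 + ε) * L := by linarith
    have := mul_le_mul_of_nonneg_right h4 ht0
    linarith

end SumQuotient

/-! ### Duals of vector-valued `ℓ_p` spaces. -/

section Duality

variable {𝕜 : Type*} [RCLike 𝕜] {E : ℕ → Type*} [∀ i, NormedAddCommGroup (E i)]
  [∀ i, NormedSpace 𝕜 (E i)] {p q : ℝ≥0∞} [Fact (1 ≤ p)]

theorem ContinuousLinearMap.exists_half_opNorm_le {X Y : Type*} [NormedAddCommGroup X]
    [NormedSpace 𝕜 X] [NormedAddCommGroup Y] [NormedSpace 𝕜 Y] (T : X →L[𝕜] Y) :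
    ∃ x, ‖x‖ ≤ 1 ∧ ‖T‖ / 2 ≤ ‖T x‖ := by
  rcases (norm_nonneg T).eq_or_lt with h | h
  · exact ⟨0, by simp, by simp [← h]⟩
  · obtain ⟨x, hx1, hx2⟩ := T.exists_lt_apply_of_lt_opNorm (half_lt_self h)
    exact ⟨x, hx1.le, hx2.le⟩

/-- The functional is tested on the extremal vector of Hölder's inequality, with coefficients
`β_j^{q-1}` rotated to make every term positive. -/
theorem lp.sum_norm_apply_single_rpow_le (h : p.toReal.HolderConjugate q.toReal)
    (ψ : StrongDual 𝕜 (lp E p)) (u : ∀ j, E j) (hu : ∀ j, ‖u j‖ ≤ 1) (s : Finset ℕ) :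
    ∑ j ∈ s, ‖ψ (lp.single p j (u j))‖ ^ q.toReal ≤ ‖ψ‖ ^ q.toReal := by
  have hp0 : 0 < p.toReal := h.pos
  have hq0 : 0 < q.toReal := h.symm.pos
  set β : ℕ → ℝ := fun j => ‖ψ (lp.single p j (u j))‖ with hβ
  have hβ0 : ∀ j, 0 ≤ β j := fun j => norm_nonneg _
  choose c hc1 hc2 using fun j => RCLike.exists_norm_eq_mul_self (ψ (lp.single p j (u j)))
  set A := ∑ j ∈ s, β j ^ q.toReal with hA
  have hA0 : 0 ≤ A := Finset.sum_nonneg fun j _ => Real.rpow_nonneg (hβ0 j) _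
  set x : ∀ j, E j := fun j => (((β j ^ (q.toReal - 1) : ℝ) : 𝕜) * c j) • u j with hx
  have hx1 : ∀ j, ‖x j‖ ^ p.toReal ≤ β j ^ q.toReal := by
    intro j
    have h1 : ‖x j‖ ≤ β j ^ (q.toReal - 1) := by
      rw [hx]
      simp only [norm_smul, norm_mul, hc1, mul_one, RCLike.norm_ofReal]
      rw [abs_of_nonneg (Real.rpow_nonneg (hβ0 j) _)]
      exact mul_le_of_le_one_right (Real.rpow_nonneg (hβ0 j) _) (hu j)
    have h2 := Real.rpow_le_rpow (norm_nonneg _) h1 hp0.le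
    rwa [← Real.rpow_mul (hβ0 j), h.symm.sub_one_mul_conj] at h2
  set z : lp E p := ∑ j ∈ s, lp.single p j (x j) with hz
  have hzn : ‖z‖ ≤ A ^ (1 / p.toReal) := by
    rw [← Real.rpow_le_rpow_iff (norm_nonneg _) (Real.rpow_nonneg hA0 _) hp0,
      ← Real.rpow_mul hA0, one_div_mul_cancel hp0.ne', Real.rpow_one, hz,
      lp.norm_sum_single hp0]
    exact Finset.sum_le_sum fun j _ => hx1 j
  have hψz : ψ z = ((A : ℝ) : 𝕜) := by
    rw [hz, map_sum, hA, RCLike.ofReal_sum]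
    refine Finset.sum_congr rfl fun j _ => ?_
    rw [hx]
    simp only
    rw [lp.single_smul, map_smul, smul_eq_mul, mul_assoc, ← hc2, ← RCLike.ofReal_mul]
    congr 1
    change β j ^ (q.toReal - 1) * β j = _
    rw [← Real.rpow_add_one' (hβ0 j) (by linarith), sub_add_cancel]
  have hle : A ≤ ‖ψ‖ * A ^ (1 / p.toReal) := by
    have h1 := ψ.le_opNorm z
    rw [hψz, RCLike.norm_ofReal, abs_of_nonneg hA0] at h1
    exact h1.trans (mul_le_mul_of_nonneg_left hzn (norm_nonneg _))
  rcases hA0.eq_or_lt with h0 | h0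
  · rw [← h0]; exact Real.rpow_nonneg (norm_nonneg _) _
  · have h1 : A ^ (1 / q.toReal) ≤ ‖ψ‖ := by
      refine le_of_mul_le_mul_right ?_ (Real.rpow_pos_of_pos h0 (1 / p.toReal))
      rw [← Real.rpow_add h0]
      have : 1 / q.toReal + 1 / p.toReal = 1 := by
        rw [one_div, one_div, add_comm]; exact h.inv_add_inv_eq_one
      rwa [this, Real.rpow_one]
    have h2 := Real.rpow_le_rpow (Real.rpow_nonneg hA0 _) h1 hq0.le
    rwa [← Real.rpow_mul hA0, one_div_mul_cancel hq0.ne', Real.rpow_one] at h2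

/-- The factor `2` comes from choosing unit-ball vectors that only half attain the norms of the
components. -/
theorem lp.sum_norm_comp_single_rpow_le (h : p.toReal.HolderConjugate q.toReal)
    (ψ : StrongDual 𝕜 (lp E p)) (s : Finset ℕ) :
    ∑ j ∈ s, ‖ψ ∘L lp.singleContinuousLinearMap 𝕜 E p j‖ ^ q.toReal ≤ (2 * ‖ψ‖) ^ q.toReal := by
  have hq0 : 0 < q.toReal := h.symm.pos
  choose u hu1 hu2 using fun j =>
    (ψ ∘L lp.singleContinuousLinearMap 𝕜 E p j).exists_half_opNorm_le
  rw [Real.mul_rpow zero_le_two (norm_nonneg _)]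
  refine le_trans ?_ (mul_le_mul_of_nonneg_left (lp.sum_norm_apply_single_rpow_le h ψ u hu1 s)
    (Real.rpow_nonneg zero_le_two _))
  rw [Finset.mul_sum]
  refine Finset.sum_le_sum fun j _ => ?_
  rw [← Real.mul_rpow zero_le_two (norm_nonneg _)]
  refine Real.rpow_le_rpow (norm_nonneg _) ?_ hq0.le
  have h1 : ‖ψ ∘L lp.singleContinuousLinearMap 𝕜 E p j‖ / 2 ≤ ‖ψ (lp.single p j (u j))‖ := hu2 j
  linarith

theorem lp.hasSum_apply_single (hp : p ≠ ∞) (ψ : StrongDual 𝕜 (lp E p)) (z : lp E p) :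
    HasSum (fun j => ψ (lp.single p j (z j))) (ψ z) :=
  (lp.hasSum_single hp z).mapL ψ

/-- If the duals of the `E j` embed uniformly into the `F j`, then the dual of `lp E p` embeds into
`lp F q`. -/
theorem lp.exists_dual_embedding [Fact (1 ≤ q)] (hp : p ≠ ∞) (h : p.toReal.HolderConjugate q.toReal)
    {F : ℕ → Type*} [∀ i, NormedAddCommGroup (F i)] [∀ i, NormedSpace 𝕜 (F i)]
    (c : ∀ j, StrongDual 𝕜 (E j) →L[𝕜] F j) {m K : ℝ} (hm : 0 < m) (hK : 0 ≤ K)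
    (hcm : ∀ j u, m * ‖u‖ ≤ ‖c j u‖) (hcK : ∀ j u, ‖c j u‖ ≤ K * ‖u‖) :
    ∃ J : StrongDual 𝕜 (lp E p) →L[𝕜] lp F q,
      (∀ ψ j, J ψ j = c j (ψ ∘L lp.singleContinuousLinearMap 𝕜 E p j)) ∧
      ∀ ψ, m * ‖ψ‖ ≤ ‖J ψ‖ := by
  have hq0 : 0 < q.toReal := h.symm.pos
  have hsum : ∀ (ψ : StrongDual 𝕜 (lp E p)) (s : Finset ℕ),
      ∑ j ∈ s, ‖c j (ψ ∘L lp.singleContinuousLinearMap 𝕜 E p j)‖ ^ q.toReal ≤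
        (K * 2 * ‖ψ‖) ^ q.toReal := by
    intro ψ s
    rw [mul_assoc, Real.mul_rpow hK (by positivity)]
    refine le_trans ?_ (mul_le_mul_of_nonneg_left (lp.sum_norm_comp_single_rpow_le h ψ s)
      (Real.rpow_nonneg hK _))
    rw [Finset.mul_sum]
    refine Finset.sum_le_sum fun j _ => ?_
    rw [← Real.mul_rpow hK (norm_nonneg _)]
    exact Real.rpow_le_rpow (norm_nonneg _) (hcK j _) hq0.le
  let J₀ : StrongDual 𝕜 (lp E p) →ₗ[𝕜] lp F q :=
    { toFun := fun ψ => ⟨fun j => c j (ψ ∘L lp.singleContinuousLinearMap 𝕜 E p j),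
        memℓp_gen' (hsum ψ)⟩
      map_add' := fun ψ χ => by
        apply lp.ext
        funext j
        exact (congrArg (c j) (ContinuousLinearMap.add_comp _ _ _)).trans (map_add (c j) _ _)
      map_smul' := fun a ψ => by
        apply lp.ext
        funext j
        exact (congrArg (c j) (ContinuousLinearMap.smul_comp _ _ _)).trans (map_smul (c j) a _) }
  refine ⟨J₀.mkContinuous (K * 2) fun ψ => lp.norm_le_of_forall_sum_le hq0 (by positivity) (hsum ψ),
    fun ψ j => rfl, fun ψ => ?_⟩
  set b : lp F q := J₀ ψ with hb
  change m * ‖ψ‖ ≤ ‖b‖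
  rw [mul_comm, ← le_div_iff₀ hm]
  refine ContinuousLinearMap.opNorm_le_bound _ (by positivity) fun z => ?_
  rw [div_mul_eq_mul_div, le_div_iff₀ hm, mul_comm ‖b‖]
  -- Hölder for the sequences of component norms bounds `ψ z`, expanded along the coordinates of
  -- `z`.
  obtain ⟨h1, h2⟩ := lp.tsum_mul_le_mul_norm h (lp.toNorm z) (lp.toNorm b)
  rw [lp.norm_toNorm, lp.norm_toNorm] at h2
  simp only [lp.toNorm, norm_norm] at h1 h2
  refine le_trans ?_ h2
  have h3 := lp.hasSum_apply_single hp ψ z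
  have h4 : ∀ j, ‖ψ (lp.single p j (z j))‖ ≤ ‖z j‖ * ‖b j‖ * m⁻¹ := by
    intro j
    have h5 := (ψ ∘L lp.singleContinuousLinearMap 𝕜 E p j).le_opNorm (z j)
    have h6 : m * ‖ψ ∘L lp.singleContinuousLinearMap 𝕜 E p j‖ ≤ ‖b j‖ := hcm j _
    refine h5.trans ?_
    rw [mul_assoc, mul_comm]
    refine mul_le_mul_of_nonneg_left ?_ (norm_nonneg _)
    rwa [← div_eq_mul_inv, le_div_iff₀ hm, mul_comm]
  have h7 := tsum_of_norm_bounded (h1.mul_right m⁻¹).hasSum h4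
  rw [h3.tsum_eq, tsum_mul_right, ← div_eq_mul_inv, le_div_iff₀ hm] at h7
  exact h7

end Duality

/-! ### Duals of the concrete sequence spaces. -/

section SequenceDuals

variable {𝕜 : Type} [RCLike 𝕜] {p q : ℝ≥0∞} [Fact (1 ≤ p)] [Fact (1 ≤ q)]

theorem exists_dual_embedding_seqLp (hp : p ≠ ∞) (h : p.toReal.HolderConjugate q.toReal) :
    ∃ J : StrongDual 𝕜 (SeqLp 𝕜 p) →L[𝕜] SeqLp 𝕜 q,
      (∀ ψ j, J ψ j = ψ (lp.single p j (1 : 𝕜))) ∧ ∀ ψ, ‖ψ‖ ≤ ‖J ψ‖ := by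
  have hev : ∀ u : StrongDual 𝕜 𝕜, ‖u‖ = ‖u 1‖ := fun u => by
    refine le_antisymm (ContinuousLinearMap.opNorm_le_bound _ (norm_nonneg _) fun x => ?_) ?_
    · have : u x = x * u 1 := by rw [← smul_eq_mul, ← map_smul, smul_eq_mul, mul_one]
      rw [this, norm_mul, mul_comm]
    · have := u.le_opNorm 1
      rwa [norm_one, mul_one] at this
  obtain ⟨J, hJ1, hJ2⟩ := lp.exists_dual_embedding (E := fun _ : ℕ => 𝕜) (F := fun _ : ℕ => 𝕜) hp h
    (fun _ => ContinuousLinearMap.apply 𝕜 𝕜 (1 : 𝕜)) one_pos zero_le_one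
    (fun _ u => by rw [one_mul, hev u]; exact le_rfl)
    (fun _ u => by rw [one_mul, hev u]; exact le_rfl)
  exact ⟨J, hJ1, fun ψ => by simpa using hJ2 ψ⟩

/-- An embedding suffices, as the failure of `P₂` passes to any Banach space containing a copy of
the dual of `X_{p,w}`. -/
theorem exists_dual_embedding_sumSeqL2 (hp : p ≠ ∞) (h : p.toReal.HolderConjugate q.toReal) :
    ∃ J : StrongDual 𝕜 (SumSeqL2 𝕜 p) →L[𝕜] SumSeqL2 𝕜 q, ∀ ψ, ‖ψ‖ ≤ ‖J ψ‖ := by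
  obtain ⟨J₂, -, hJ₂⟩ := exists_dual_embedding_seqLp (𝕜 := 𝕜) (p := 2) (q := 2) (by norm_num)
    (by simpa using Real.HolderConjugate.two_two)
  obtain ⟨J, -, hJ⟩ := lp.exists_dual_embedding (E := fun _ : ℕ => SeqLp 𝕜 2)
    (F := fun _ : ℕ => SeqLp 𝕜 2) hp h (fun _ => J₂) one_pos (norm_nonneg J₂)
    (fun _ u => by rw [one_mul]; exact hJ₂ u) fun _ u => J₂.le_opNorm u
  exact ⟨J, fun ψ => by simpa using hJ ψ⟩

/-- The dual of a subspace of `ℓ_p` is a quotient of `ℓ_q`. -/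
theorem exists_surjective_dual_subspace [p.HolderConjugate q] (hp : p ≠ ∞)
    (h : p.toReal.HolderConjugate q.toReal) (V : Submodule 𝕜 (SeqLp 𝕜 p)) :
    ∃ π : SeqLp 𝕜 q →L[𝕜] StrongDual 𝕜 V, Function.Surjective π := by
  have hmul : ∀ _ : ℕ, ‖ContinuousLinearMap.mul 𝕜 𝕜‖ ≤ (1 : NNReal) := fun _ =>
    ContinuousLinearMap.opNorm_mul_le 𝕜 𝕜
  have : q.HolderConjugate p := ENNReal.HolderConjugate.symm
  let B : SeqLp 𝕜 q →L[𝕜] StrongDual 𝕜 (SeqLp 𝕜 p) :=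
    lp.dualPairing q p (fun _ : ℕ => ContinuousLinearMap.mul 𝕜 𝕜) hmul
  refine ⟨(ContinuousLinearMap.precomp 𝕜 V.subtypeL) ∘L B, fun φ => ?_⟩
  -- A Hahn–Banach extension to `ℓ_p` is represented by its values on the unit vectors, which form
  -- an element of `ℓ_q`.
  obtain ⟨ψ, hψ, -⟩ := exists_extension_norm_eq V φ
  obtain ⟨J, hJ, -⟩ := exists_dual_embedding_seqLp (𝕜 := 𝕜) hp h
  refine ⟨J ψ, ?_⟩
  ext v
  change B (J ψ) (v : SeqLp 𝕜 p) = φ v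
  rw [← hψ v]
  have h1 : B (J ψ) (v : SeqLp 𝕜 p) = ∑' j, J ψ j * (v : SeqLp 𝕜 p) j := rfl
  rw [h1, ← (lp.hasSum_apply_single hp ψ (v : SeqLp 𝕜 p)).tsum_eq]
  refine tsum_congr fun j => ?_
  rw [hJ, mul_comm, ← smul_eq_mul, ← map_smul, ← lp.single_smul, smul_eq_mul, mul_one]

end SequenceDuals

/-! ### Surjections onto `X_{p,w}` and the final contradiction. -/

section Images

variable {𝕜 : Type} [RCLike 𝕜] {p q : ℝ≥0∞} [Fact (1 ≤ p)] [Fact (1 ≤ q)] {w : ℕ → ℝ}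

instance XSpace.instCompleteSpace : CompleteSpace (XSpace 𝕜 p w) := by
  have hiso : Isometry (XSpace.toProd 𝕜 p w) :=
    AddMonoidHomClass.isometry_of_norm _ fun _ => rfl
  rw [completeSpace_iff_isComplete_range hiso.isUniformInducing]
  refine IsClosed.isComplete ?_
  have hrange : Set.range (XSpace.toProd 𝕜 p w) =
      ⋂ n, {z | (z.2 : ℕ → 𝕜) n = (w n : 𝕜) * (z.1 : ℕ → 𝕜) n} := by
    ext z
    simp only [Set.mem_range, Set.mem_iInter, Set.mem_ofPred_eq]
    constructor
    · rintro ⟨x, rfl⟩ n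
      rfl
    · intro hz
      have h2 : (fun n => (w n : 𝕜) * (z.1 : ℕ → 𝕜) n) = z.2 := funext fun n => (hz n).symm
      refine ⟨⟨z.1, lp.memℓp z.1, ?_⟩, Prod.ext (lp.ext rfl) (lp.ext h2)⟩
      rw [h2]
      exact lp.memℓp z.2
  rw [hrange]
  refine isClosed_iInter fun n => isClosed_eq ?_ ?_
  · exact (lp.evalCLM 𝕜 (fun _ : ℕ => 𝕜) 2 n).continuous.comp continuous_snd
  · exact continuous_const.mul
      ((lp.evalCLM 𝕜 (fun _ : ℕ => 𝕜) p n).continuous.comp continuous_fst)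

/-- A surjection from `A × B` onto `X` induces an embedding of the dual of `X` into
`A' ⊕ B*` whenever the dual of `A` embeds into `A'`. -/
theorem exists_dual_embedding_of_surjective {A B X A' : Type*} [NormedAddCommGroup A]
    [NormedSpace 𝕜 A] [NormedAddCommGroup B] [NormedSpace 𝕜 B] [NormedAddCommGroup X]
    [NormedSpace 𝕜 X] [NormedAddCommGroup A'] [NormedSpace 𝕜 A'] [CompleteSpace A]
    [CompleteSpace B] [CompleteSpace X] (JA : StrongDual 𝕜 A →L[𝕜] A')
    (hJA : ∀ ψ, ‖ψ‖ ≤ ‖JA ψ‖) (T : (A × B) →L[𝕜] X) (hT : Function.Surjective T) :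
    ∃ (J : StrongDual 𝕜 X →L[𝕜] WithLp 2 (A' × StrongDual 𝕜 B)) (c : ℝ), 0 < c ∧
      ∀ ψ, c * ‖ψ‖ ≤ ‖J ψ‖ := by
  obtain ⟨C, hC, hlift⟩ := T.exists_preimage_norm_le hT
  let T₁ : A →L[𝕜] X := T ∘L ContinuousLinearMap.inl 𝕜 _ _
  let T₂ : B →L[𝕜] X := T ∘L ContinuousLinearMap.inr 𝕜 _ _
  let J₁ : StrongDual 𝕜 X →L[𝕜] A' := JA ∘L ContinuousLinearMap.precomp 𝕜 T₁
  let J₂ : StrongDual 𝕜 X →L[𝕜] StrongDual 𝕜 B := ContinuousLinearMap.precomp 𝕜 T₂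
  let J : StrongDual 𝕜 X →L[𝕜] WithLp 2 (A' × StrongDual 𝕜 B) :=
    ((WithLp.prodContinuousLinearEquiv 2 𝕜 A' (StrongDual 𝕜 B)).symm : _ →L[𝕜] _) ∘L J₁.prod J₂
  -- `C` is the lifting constant of `T`; the factor `2` comes from splitting a lift into its two
  -- components.
  refine ⟨J, (C * 2)⁻¹, by positivity, fun ψ => ?_⟩
  have h1 : ‖J₁ ψ‖ ≤ ‖J ψ‖ := WithLp.norm_fst_le _ (J ψ)
  have h2 : ‖J₂ ψ‖ ≤ ‖J ψ‖ := WithLp.norm_snd_le _ (J ψ)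
  have h3 : ‖ψ ∘L T₁‖ ≤ ‖J ψ‖ := (hJA _).trans h1
  rw [inv_mul_eq_div, div_le_iff₀ (by positivity)]
  refine ContinuousLinearMap.opNorm_le_bound _ (by positivity) fun x => ?_
  obtain ⟨z, hz, hzx⟩ := hlift x
  have hz' : x = T₁ z.1 + T₂ z.2 := by
    rw [← hz]
    change T z = T (z.1, 0) + T (0, z.2)
    rw [← map_add, Prod.mk_add_mk, add_zero, zero_add]
  have h4 : ‖ψ (T₁ z.1)‖ ≤ ‖J ψ‖ * ‖z‖ :=
    ((ψ ∘L T₁).le_opNorm z.1).trans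
      (mul_le_mul h3 (norm_fst_le z) (norm_nonneg _) (norm_nonneg _))
  have h5 : ‖ψ (T₂ z.2)‖ ≤ ‖J ψ‖ * ‖z‖ :=
    ((J₂ ψ).le_opNorm z.2).trans
      (mul_le_mul h2 (norm_snd_le z) (norm_nonneg _) (norm_nonneg _))
  have h6 : ‖ψ x‖ ≤ 2 * (‖J ψ‖ * ‖z‖) := by
    rw [hz', map_add]
    linarith [norm_add_le (ψ (T₁ z.1)) (ψ (T₂ z.2))]
  calc ‖ψ x‖ ≤ 2 * (‖J ψ‖ * ‖z‖) := h6
    _ ≤ 2 * (‖J ψ‖ * (C * ‖x‖)) := by gcongr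
    _ = ‖J ψ‖ * (C * 2) * ‖x‖ := by ring

theorem not_surjective_to_xSpace_of_dual_quotient [p.HolderConjugate q] (hp : p ≠ ∞) (hp2 : 2 < p.toReal)
    (h : p.toReal.HolderConjugate q.toReal) (hq : q ≠ ∞) (hw : ∀ n, 0 < w n)
    (hstar : ConditionStar p w) {B : Type*} [NormedAddCommGroup B] [NormedSpace 𝕜 B]
    [CompleteSpace B]
    (π : SeqLp 𝕜 q →L[𝕜] StrongDual 𝕜 B) (hπ : Function.Surjective π)
    (T : (SumSeqL2 𝕜 p × B) →L[𝕜] XSpace 𝕜 p w) :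
    ¬ Function.Surjective T := by
  intro hT
  obtain ⟨JW, hJW⟩ := exists_dual_embedding_sumSeqL2 (𝕜 := 𝕜) hp h
  obtain ⟨J, c, hc, hJ⟩ := exists_dual_embedding_of_surjective JW hJW T hT
  exact not_propertyP2_of_embedding hp hp2 hw hstar J hc hJ (propertyP2_withLp hq h hp2 π hπ 2)

theorem not_surjective_to_xSpace [p.HolderConjugate q] (hp : p ≠ ∞) (hp2 : 2 < p.toReal)
    (h : p.toReal.HolderConjugate q.toReal) (hq : q ≠ ∞) (hw : ∀ n, 0 < w n)
    (hstar : ConditionStar p w) (V : Submodule 𝕜 (SeqLp 𝕜 p))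
    (hV : IsClosed (V : Set (SeqLp 𝕜 p))) (T : (SumSeqL2 𝕜 p × V) →L[𝕜] XSpace 𝕜 p w) :
    ¬ Function.Surjective T := by
  have : CompleteSpace V := hV.completeSpace_coe
  obtain ⟨π, hπ⟩ := exists_surjective_dual_subspace (q := q) hp h V
  exact not_surjective_to_xSpace_of_dual_quotient hp hp2 h hq hw hstar π hπ T

end Images

theorem lp.evalCLM_surjective {𝕜 : Type*} [RCLike 𝕜] {E : ℕ → Type*} [∀ i, NormedAddCommGroup (E i)]
    [∀ i, NormedSpace 𝕜 (E i)] {p : ℝ≥0∞} [Fact (1 ≤ p)] (i : ℕ) :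
    Function.Surjective (lp.evalCLM 𝕜 E p i) := fun x =>
  ⟨lp.single p i x, lp.single_apply_self p i x⟩

theorem theorem2p21 {𝕜 : Type} [RCLike 𝕜] (p q : ℝ≥0∞) [Fact (1 ≤ p)] [Fact (1 ≤ q)]
    (hp2 : 2 < p) (hp : p < ∞) (hpq : p.HolderConjugate q)
    (w : ℕ → ℝ) (hw : ∀ n, 0 < w n) (hstar : ConditionStar p w) :
    -- `X_{p,w}` is not a continuous linear image of `(ℓ_2 ⊕ ℓ_2 ⊕ ⋯)_{ℓ_p} ⊕ V`
    (∀ V : Submodule 𝕜 (SeqLp 𝕜 p), IsClosed (V : Set (SeqLp 𝕜 p)) →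
      ¬ ∃ T : (SumSeqL2 𝕜 p × V) →L[𝕜] XSpace 𝕜 p w, Function.Surjective T) ∧
    -- the dual of `X_{p,w}` fails `P₂`, under every equivalent norm
    (¬ PropertyP2 𝕜 (StrongDual 𝕜 (XSpace 𝕜 p w)) ∧
      ∀ (Y : Type*) [NormedAddCommGroup Y] [NormedSpace 𝕜 Y] [CompleteSpace Y],
        Nonempty (StrongDual 𝕜 (XSpace 𝕜 p w) ≃L[𝕜] Y) → ¬ PropertyP2 𝕜 Y) ∧
    -- `(ℓ_2 ⊕ ℓ_2 ⊕ ⋯)_{ℓ_q} ⊕ Y` satisfies `P₂` for `Y` isomorphic to a quotient of `ℓ_q`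
    (∀ M : Submodule 𝕜 (SeqLp 𝕜 q), IsClosed (M : Set (SeqLp 𝕜 q)) →
      ∀ (Y : Type*) [NormedAddCommGroup Y] [NormedSpace 𝕜 Y] [CompleteSpace Y],
        Nonempty ((SeqLp 𝕜 q ⧸ M) ≃L[𝕜] Y) →
          ∀ (r : ℝ≥0∞) [Fact (1 ≤ r)], PropertyP2 𝕜 (WithLp r (SumSeqL2 𝕜 q × Y))) ∧
    -- `X_{p,w}` is isomorphic to none of the four classical sequence spaces
    (IsEmpty (XSpace 𝕜 p w ≃L[𝕜] SeqLp 𝕜 2) ∧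
      IsEmpty (XSpace 𝕜 p w ≃L[𝕜] SeqLp 𝕜 p) ∧
      IsEmpty (XSpace 𝕜 p w ≃L[𝕜] (SeqLp 𝕜 2 × SeqLp 𝕜 p)) ∧
      IsEmpty (XSpace 𝕜 p w ≃L[𝕜] SumSeqL2 𝕜 p)) := by
  have hp' : p ≠ ∞ := hp.ne
  have hp2' : 2 < p.toReal := by
    have := (ENNReal.toReal_lt_toReal (by norm_num) hp').2 hp2
    simpa using this
  have h : p.toReal.HolderConjugate q.toReal :=
    (ENNReal.HolderConjugate.toReal_iff (by linarith)).2 hpq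
  have hq : q ≠ ∞ := by
    rintro rfl
    simpa using h.symm.pos
  have hsurj : ∀ V : Submodule 𝕜 (SeqLp 𝕜 p), IsClosed (V : Set (SeqLp 𝕜 p)) →
      ∀ T : (SumSeqL2 𝕜 p × V) →L[𝕜] XSpace 𝕜 p w, ¬ Function.Surjective T :=
    not_surjective_to_xSpace (q := q) hp' hp2' h hq hw hstar
  have htop : IsClosed ((⊤ : Submodule 𝕜 (SeqLp 𝕜 p)) : Set (SeqLp 𝕜 p)) := isClosed_univ
  have hsub : Function.Surjective (⊤ : Submodule 𝕜 (SeqLp 𝕜 p)).subtypeL := fun x =>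
    ⟨⟨x, trivial⟩, rfl⟩
  -- With `V` all of `ℓ_p`, a space isomorphic to `X_{p,w}` cannot be a quotient of the `ℓ_p`-sum
  -- plus `ℓ_p`; each of the four classical spaces is one by coordinate projections.
  have hiso : ∀ {Z : Type} [NormedAddCommGroup Z] [NormedSpace 𝕜 Z] (_ : XSpace 𝕜 p w ≃L[𝕜] Z)
      (g : (SumSeqL2 𝕜 p × (⊤ : Submodule 𝕜 (SeqLp 𝕜 p))) →L[𝕜] Z), ¬ Function.Surjective g :=
    fun e g hg => hsurj ⊤ htop (e.symm.toContinuousLinearMap.comp g) (e.symm.surjective.comp hg)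
  refine ⟨fun V hV ⟨T, hT⟩ => hsurj V hV T hT, ⟨?_, ?_⟩, ?_, ⟨fun e => ?_⟩, ⟨fun e => ?_⟩,
    ⟨fun e => ?_⟩, ⟨fun e => ?_⟩⟩
  · exact not_propertyP2_of_embedding hp' hp2' hw hstar (ContinuousLinearMap.id 𝕜 _) one_pos
      fun x => by rw [one_mul]; exact le_rfl
  · rintro Y _ _ _ ⟨e⟩
    refine not_propertyP2_of_embedding hp' hp2' hw hstar (e : _ →L[𝕜] Y)
      (c := (‖(e.symm : Y →L[𝕜] StrongDual 𝕜 (XSpace 𝕜 p w))‖ + 1)⁻¹) (by positivity) fun x => ?_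
    rw [inv_mul_eq_div, div_le_iff₀ (by positivity)]
    have h1 := (e.symm : Y →L[𝕜] StrongDual 𝕜 (XSpace 𝕜 p w)).le_opNorm (e x)
    rw [ContinuousLinearEquiv.coe_coe, e.symm_apply_apply] at h1
    have h2 := norm_nonneg (e x)
    change ‖x‖ ≤ ‖e x‖ * _
    linarith
  · rintro M hM Y _ _ _ ⟨e⟩ r _
    exact propertyP2_withLp hq h hp2' (e.toContinuousLinearMap.comp M.mkQL)
      (e.surjective.comp M.mkQ_surjective) r
  · exact hiso e (lp.evalCLM 𝕜 (fun _ : ℕ => SeqLp 𝕜 2) p 0 ∘L ContinuousLinearMap.fst 𝕜 _ _)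
      ((lp.evalCLM_surjective (𝕜 := 𝕜) 0).comp Prod.fst_surjective)
  · exact hiso e ((⊤ : Submodule 𝕜 (SeqLp 𝕜 p)).subtypeL ∘L ContinuousLinearMap.snd 𝕜 _ _)
      (hsub.comp Prod.snd_surjective)
  · exact hiso e ((lp.evalCLM 𝕜 (fun _ : ℕ => SeqLp 𝕜 2) p 0).prodMap
      (⊤ : Submodule 𝕜 (SeqLp 𝕜 p)).subtypeL) ((lp.evalCLM_surjective (𝕜 := 𝕜) 0).prodMap hsub)
  · exact hiso e (ContinuousLinearMap.fst 𝕜 _ _) Prod.fst_surjective
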